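/- Let $\mathcal A=\{\mathtt e,\mathtt n,\mathtt w,\mathtt s\}$, identified with the unit vectors $(1,0),(0,1),(-1,0),(0,-1)$ of $\mathbb Z^2$; $\mathtt e,\mathtt w$ are horizontal and $\mathtt n,\mathtt s$ vertical. The quadruple-infinite comb has the leaves $\ell^n\ell'$ ($\ell\ne\ell'\in\mathcal A$, $n\ge1$) and $\ell^\infty$ ($\ell\in\mathcal A$); to each leaf $c$ a probability distribution $q_c$ on $\mathcal A$ is attached. For a left-infinite word $u$, let $\mathrm{pref}(u)$ be the leaf $\ell^n\ell'$ if $u=\cdots\ell'\ell^n$, and $\ell^\infty$ if all letters of $u$ equal $\ell$. Let $U_n=\cdots X_{n-1}X_n$ $(n\ge 0)$ be the associated variable length Markov chain: $U_{n+1}=U_nX_{n+1}$, and for $n\ge1$ the conditional distribution of $X_{n+1}$ given $U_0,\dots,U_n$ is $q_{\mathrm{pref}(U_n)}$. Assume that time $0$ is a vertical-to-horizontal change of direction: almost surely $X_0$ is vertical and $X_1$ is horizontal. The quadruple-infinite comb persistent random walk is $S_n=\sum_{k=1}^nX_k$, $S_0=0$. Write $\alpha_n(\ell',\ell)=1-q_{\ell^n\ell'}(\ell)$.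 Let $\nu_{\mathtt h},\nu_{\mathtt v}$ be probability distributions on $\{1,2,\dots\}$, let $p_{\mathtt h},p_{\mathtt v}\in[0,1)$, and put $p_{\mathtt e}=p_{\mathtt w}=\frac{1-p_{\mathtt v}}2$, $p_{\mathtt n}=p_{\mathtt s}=\frac{1-p_{\mathtt h}}2$. Assume that for all $\ell'\neq\ell$ in $\mathcal A$ (if $\ell'=-\ell$, only when $p_{\mathtt h}>0$ and $\ell$ is horizontal, or $p_{\mathtt v}>0$ and $\ell$ is vertical) and all $n\ge1$: (H1) the persistence time in direction $\ell$ after direction $\ell'$ has the distribution $\nu:=\nu_{\mathtt h}$ if $\ell$ is horizontal, $\nu:=\nu_{\mathtt v}$ if $\ell$ is vertical, that is, $\alpha_n(\ell',\ell)\prod_{k=1}^{n-1}(1-\alpha_k(\ell',\ell))=\nu(n)$; (H2) a change of direction leads to each direction $m$ orthogonal to $\ell$ with probability $p_m$, independently of the time spent in direction $\ell$, that is, $q_{\ell^n\ell'}(m)=\alpha_n(\ell',\ell)\,p_m$ whenever $\prod_{k=1}^{n-1}(1-\alpha_k(\ell',\ell))\neq0$ (so the direction is reversed with the remaining probability, $p_{\mathtt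 h}$ or $p_{\mathtt v}$). Let $\{H_n\}_{n\ge0}$ and $\{V_n\}_{n\ge0}$ be two independent random walks on $\mathbb Z$ starting from the origin, with i.i.d. jumps distributed respectively as $$\varepsilon\sum_{k=1}^{G_{\mathtt h}}(-1)^{k-1}\tau_k^{\mathtt h}\quad\text{and}\quad \varepsilon\sum_{k=1}^{G_{\mathtt v}}(-1)^{k-1}\tau_k^{\mathtt v},$$ where $\varepsilon$ is uniform on $\{-1,1\}$, $G_{\mathtt h},G_{\mathtt v}$ are geometric on $\{1,2,\dots\}$ with parameters $1-p_{\mathtt h}$, $1-p_{\mathtt v}$ (so $\mathbb P(G_{\mathtt h}=k)=p_{\mathtt h}^{k-1}(1-p_{\mathtt h})$), the $\tau_k^{\mathtt h}$ and $\tau_k^{\mathtt v}$ are distributed as $\nu_{\mathtt h}$ and $\nu_{\mathtt v}$, and all these variables are independent. Then the origin is recurrent for $\{S_n\}_{n\ge 0}$, i.e. $\mathbb P(S_n=0\text{ infinitely often})=1$, if and only if $$\sum_{n=0}^\infty \mathbb P(H_{n+1}=0)\,\mathbb P(0\le V_n\le V_{n+1}-V_n)=\infty\quad\text{or}\quad\sum_{n=0}^\infty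 \mathbb P(V_{n+1}=0)\,\mathbb P(0\le H_n\le H_{n+1}-H_n)=\infty.$$ -/

import Mathlib

open MeasureTheory ProbabilityTheory Filter
open scoped ENNReal

namespace QuadComb

/-- The alphabet: moves to the east, north, west and south. -/
inductive Letter
  | e
  | n
  | w
  | s
  deriving DecidableEq

instance : MeasurableSpace Letter := ⊤

/-- The unit vector of `ℤ²` attached to a letter. -/
def Letter.dir : Letter → ℤ × ℤ
  | .e => (1, 0)
  | .n => (0, 1)
  | .w => (-1, 0)
  | .s => (0, -1)

/-- East and west are the horizontal letters. -/
def Letter.IsHorizontal : Letter → Prop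
  | .e => True
  | .w => True
  | .n => False
  | .s => False

/-- North and south are the vertical letters. -/
def Letter.IsVertical (l : Letter) : Prop := ¬ l.IsHorizontal

/-- Two letters are orthogonal if exactly one of them is horizontal. -/
def Letter.Orthogonal (l m : Letter) : Prop := ¬ (l.IsHorizontal ↔ m.IsHorizontal)

/-- Left-infinite words `⋯ w₂ w₁ w₀`: the letters are numbered from right to left, so that
`u 0` is the rightmost letter of `u`. -/
abbrev Word := ℕ → Letter

/-- `u.append l` is the word `u l`, obtained by writing `l` to the right of `u`. -/
def Word.append (u : Word) (l : Letter) : Word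
  | 0 => l
  | k + 1 => u k

/-- The contexts, that is, the leaves of the quadruple-infinite comb:
`run l l' h n` is the leaf `lⁿ l'` (with `l' ≠ l` and `n ≥ 1`) and `const l` is the leaf `l^∞`. -/
inductive Context
  | run (l l' : Letter) (h : l' ≠ l) (n : ℕ+)
  | const (l : Letter)

open Classical in
/-- The prefix function: reading `u` from right to left, its rightmost letter `l` is repeated
`n ≥ 1` times and then followed by some `l' ≠ l` (leaf `lⁿ l'`), or it is repeated forever
(leaf `l^∞`). -/
noncomputable def pref (u : Word) : Context :=
  if h : ∃ k, u k ≠ u 0 then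
    .run (u 0) (u (Nat.find h)) (Nat.find_spec h)
      ⟨Nat.find h, Nat.pos_of_ne_zero fun h0 => Nat.find_spec h (by rw [h0])⟩
  else .const (u 0)

/-- A probabilization of the quadruple-infinite comb: a distribution on the alphabet is attached
to each leaf. -/
abbrev ProbTree := Context → PMF Letter

/-- The variable length Markov chain `U₀, U₁, U₂, …` of the probabilized comb `q`, run from the
configuration `U₁` on (the law of `U₁` is not specified): a process of left-infinite words such
that `U_{n+1}` is `U_n` followed by one new letter, and such that for `n ≥ 1`, conditionally on
`U₀, …, U_n`, the new letter has the distribution attached to the leaf `pref U_n`. -/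
structure IsVLMC {Ω : Type*} [MeasurableSpace Ω] (μ : Measure Ω) (q : ProbTree)
    (U : ℕ → Ω → Word) : Prop where
  measurable : ∀ n, Measurable (U n)
  append : ∀ n, ∀ᵐ ω ∂μ, U (n + 1) ω = Word.append (U n ω) (U (n + 1) ω 0)
  transition : ∀ n, 1 ≤ n → ∀ l : Letter,
    μ[({ω | U (n + 1) ω 0 = l}).indicator (fun _ => (1 : ℝ)) |
        ⨆ k : Fin (n + 1), MeasurableSpace.comap (U k) inferInstance]
      =ᵐ[μ] fun ω => (q (pref (U n ω)) l).toReal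

/-- The persistent random walk `S_n = X₁ + ⋯ + X_n` on `ℤ²`, where the increment `X_k` is the
direction given by the rightmost letter of `U_k`. -/
def walk {Ω : Type*} (U : ℕ → Ω → Word) (n : ℕ) (ω : Ω) : ℤ × ℤ :=
  ∑ k ∈ Finset.Icc 1 n, (U k ω 0).dir

/-- The probability `α_n(l', l)` to change direction after `n` consecutive letters `l` that
were preceded by `l'`. -/
noncomputable def alpha (q : ProbTree) {l l' : Letter} (h : l' ≠ l) (n : ℕ+) : ℝ≥0∞ :=
  1 - q (.run l l' h n) l

/-- The probability `∏_{k=1}^{n-1} (1 - α_k(l', l))` that a run of letters `l` preceded by `l'`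
has length at least `n`. -/
noncomputable def survival (q : ProbTree) {l l' : Letter} (h : l' ≠ l) (n : ℕ+) : ℝ≥0∞ :=
  ∏ k ∈ Finset.Ico 1 n, (1 - alpha q h k)

open Classical in
/-- `byAxis a b l` is `a` if the letter `l` is horizontal and `b` if it is vertical. -/
noncomputable def byAxis {T : Type*} (a b : T) (l : Letter) : T := if l.IsHorizontal then a else b

/-- The probabilities to choose an orthogonal direction `m` when changing direction:
`p_e = p_w = (1 - p_v) / 2` and `p_n = p_s = (1 - p_h) / 2`. -/
noncomputable def turnProb (ph pv : unitInterval) (m : Letter) : ℝ :=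
  (1 - byAxis (pv : ℝ) (ph : ℝ) m) / 2

/-- The pair (previous direction `l'`, current direction `l`) is a change of direction that can
occur: `l' ≠ l`, and U-turns are considered only if they have a positive probability. -/
def Occurs (ph pv : unitInterval) (l' l : Letter) : Prop :=
  l' ≠ l ∧ (l'.Orthogonal l ∨ 0 < byAxis ph pv l)

/-- The probabilized comb `q` is that of a generalized directionally reinforced random walk.

`persistence`: the persistence time in any horizontal (resp. vertical) direction, whatever the
previous one, has distribution `νh` (resp. `νv`).

`turn`: whatever the time `n` spent in the current direction, a change of direction leads to
each orthogonal direction `m` with the probability `turnProb ph pv m`, which depends on `m` only;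
hence the change is a U-turn with the remaining probability, `ph` or `pv`.

Nothing is required of the leaves that the walk cannot meet. -/
structure IsGeneralizedDRRW (q : ProbTree) (νh νv : PMF ℕ+) (ph pv : unitInterval) : Prop where
  persistence : ∀ (l' l : Letter) (h : l' ≠ l), Occurs ph pv l' l →
    ∀ n : ℕ+, survival q h n * alpha q h n = byAxis νh νv l n
  turn : ∀ (l' l : Letter) (h : l' ≠ l), Occurs ph pv l' l →
    ∀ n : ℕ+, survival q h n ≠ 0 → ∀ m : Letter, m.Orthogonal l →
      q (.run l l' h n) m = alpha q h n * ENNReal.ofReal (turnProb ph pv m)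

/-- The distribution of a symmetric Rademacher random variable. -/
noncomputable def rademacher : Measure ℤ :=
  (2⁻¹ : ℝ≥0∞) • Measure.dirac 1 + (2⁻¹ : ℝ≥0∞) • Measure.dirac (-1)

/-- The distribution on `ℕ` of a geometric random variable `G ≥ 1` with parameter `1 - p`:
`P(G = k) = p ^ (k - 1) * (1 - p)` for `k ≥ 1`. -/
noncomputable def geometricLaw (p : unitInterval) : Measure ℕ :=
  (geometricMeasure (unitInterval.symm p)).map (· + 1)

/-- A distribution on the positive integers, seen on `ℤ`. -/
noncomputable def intLaw (ν : PMF ℕ+) : Measure ℤ := (ν.map fun t : ℕ+ => (t : ℤ)).toMeasure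

/-- The map `(ε, g, (τ₁, τ₂, …)) ↦ ε * ∑_{k=1}^{g} (-1)^{k-1} τ_k`, with `τ_{k+1} = τ k`. -/
def signedAlternatingSum (x : ℤ × ℕ × (ℕ → ℤ)) : ℤ :=
  x.1 * ∑ k ∈ Finset.range x.2.1, (-1) ^ k * x.2.2 k

theorem measurable_signedAlternatingSum : Measurable signedAlternatingSum := by
  have h : Measurable fun y : (ℕ → ℤ) × ℕ => ∑ k ∈ Finset.range y.2, (-1 : ℤ) ^ k * y.1 k := by
    refine measurable_from_prod_countable_left fun g => ?_
    show Measurable fun y : ℕ → ℤ => ∑ k ∈ Finset.range g, (-1 : ℤ) ^ k * y k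
    exact Finset.measurable_fun_sum _ fun k _ => by fun_prop
  have h' : Measurable fun x : ℤ × ℕ × (ℕ → ℤ) => (x.2.2, x.2.1) :=
    (measurable_snd.comp measurable_snd).prodMk (measurable_fst.comp measurable_snd)
  exact measurable_fst.mul (h.comp h')

/-- The distribution of `ε * ∑_{k=1}^{G} (-1)^{k-1} τ_k`, where `ε` is a Rademacher variable, `G`
is geometric with parameter `1 - p`, the `τ_k` have distribution `ν`, and all are independent. -/
noncomputable def jumpLaw (ν : PMF ℕ+) (p : unitInterval) : Measure ℤ :=
  (rademacher.prod ((geometricLaw p).prod (Measure.infinitePi fun _ : ℕ => intLaw ν))).map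
    signedAlternatingSum

/-- `M` is a random walk on `ℤ` starting from the origin, with i.i.d. jumps of law `κ`. -/
structure IsRandomWalk {Ω : Type*} [MeasurableSpace Ω] (P : Measure Ω) (κ : Measure ℤ)
    (M : ℕ → Ω → ℤ) : Prop where
  measurable : ∀ n, Measurable (M n)
  zero : ∀ᵐ ω ∂P, M 0 ω = 0
  jump_law : ∀ n, P.map (fun ω => M (n + 1) ω - M n ω) = κ
  indep : iIndepFun (fun n ω => M (n + 1) ω - M n ω) P

/-- The origin is recurrent: almost surely, it is visited infinitely often. -/
def OriginRecurrent {Ω : Type*} [MeasurableSpace Ω] (μ : Measure Ω) (S : ℕ → Ω → ℤ × ℤ) : Prop :=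
  ∀ᵐ ω ∂μ, ∃ᶠ n in atTop, S n ω = 0

end QuadComb

/-!
Between two changes of axis, the walk writes a *half-cycle*: a zigzag on one axis, made of a
geometric number of runs in alternately opposite directions. By the two conditions on the tree,
the half-cycles are independent, their first directions are fair coins (except for the very first
one, which has an arbitrary law on the horizontal directions), and the displacement during a
horizontal (vertical) half-cycle has the law of a jump of `H` (of `V`). Hence the letters of the
chain have the law of the concatenation of independent half-cycles, `wordMeasure`, up to a density
depending on the first letter only (`map_letters_eq_withDensity`), and it is enough to study the
latter.

The origin can be visited during a half-cycle only if the coordinate on the other axis is zero and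
the half-cycle meets the origin of its own axis. Since each run is the last one of its half-cycle
with a probability bounded below, the latter is comparable to a crossing of the origin by a single
jump, which is the event appearing in the series (`mean_halfWord_visits_le`). So the probabilities
of visits during the half-cycles of each of the two parities are bounded by the terms of one of the
series (`measure_segmentHits_le`), up to an index shift that is harmless because the crossing
probabilities of consecutive times are comparable (`crossProb_le_succ`, `crossProb_succ_le`). If
both series converge, the Borel–Cantelli lemma yields transience.

Conversely, if one series diverges, consider the events that one walk is at the origin while the
other one crosses it. A symmetric walk crosses from any starting point with a probability at most
a constant times that from the origin (`shifted_crossProb_le`; it is seen by writing the position as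
the sum of two independent symmetric variables). This bounds the correlations of these
events, and the Kochen–Stone lemma (`measure_limsup_ne_zero_of_correlation`) shows that infinitely
many of them occur with positive probability. By the Hewitt–Savage zero-one law
(`measure_eq_zero_or_one_of_exchangeable`), applied to the pairs of successive half-cycles, this
probability is one.
-/

namespace QuadComb

/-! ### Symmetric random walks on the integers -/

/-- The `n`-fold convolution power of `κ`: the law of the `n`-th position of a random walk on `ℤ`
started at the origin whose jumps have law `κ`. -/
noncomputable def convPow (κ : Measure ℤ) : ℕ → Measure ℤ
  | 0 => Measure.dirac 0
  | n + 1 => (convPow κ n) ∗ κ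

/-- The probability that the `n`-th position of the walk lies between `0` and the next jump. -/
noncomputable def crossProb (κ : Measure ℤ) (n : ℕ) : ℝ≥0∞ :=
  ((convPow κ n).prod κ) {p | 0 ≤ p.1 ∧ p.1 ≤ p.2}

theorem conv_apply_int (ρ σ : Measure ℤ) (A : Set ℤ) :
    (ρ ∗ σ) A = (ρ.prod σ) {p | p.1 + p.2 ∈ A} := by
  rw [Measure.conv, Measure.map_apply .of_discrete .of_discrete]
  rfl

theorem convPow_add (κ : Measure ℤ) (m n : ℕ) : convPow κ (m + n) = convPow κ m ∗ convPow κ n := by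
  induction n with
  | zero => simp [convPow]
  | succ n ih => rw [← add_assoc, convPow, ih, convPow, Measure.conv_assoc]

section Symmetric

variable {κ : Measure ℤ} [IsProbabilityMeasure κ]

instance isProbabilityMeasure_convPow (n : ℕ) : IsProbabilityMeasure (convPow κ n) := by
  induction n with
  | zero => exact Measure.dirac.isProbabilityMeasure
  | succ n ih => simp only [convPow]; infer_instance

theorem map_neg_conv {ρ σ : Measure ℤ} [IsProbabilityMeasure ρ] [IsProbabilityMeasure σ]
    (hρ : ρ.map Neg.neg = ρ) (hσ : σ.map Neg.neg = σ) : (ρ ∗ σ).map Neg.neg = ρ ∗ σ := by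
  conv_rhs => rw [← hρ, ← hσ]
  rw [Measure.conv, Measure.conv, Measure.map_prod_map _ _ .of_discrete .of_discrete,
    Measure.map_map .of_discrete .of_discrete, Measure.map_map .of_discrete .of_discrete]
  congr 1
  ext p
  simp [add_comm]

theorem map_neg_convPow (hκ : κ.map Neg.neg = κ) (n : ℕ) :
    (convPow κ n).map Neg.neg = convPow κ n := by
  induction n with
  | zero => rw [convPow, Measure.map_dirac' .of_discrete, neg_zero]
  | succ n ih => exact map_neg_conv ih hκ

theorem map_neg_left {ρ σ : Measure ℤ} [IsProbabilityMeasure ρ] [IsProbabilityMeasure σ]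
    (hρ : ρ.map Neg.neg = ρ) : (ρ.prod σ).map (fun p => (-p.1, p.2)) = ρ.prod σ := by
  conv_rhs => rw [← hρ]
  conv_rhs => rw [← Measure.map_id (μ := σ)]
  rw [Measure.map_prod_map _ _ .of_discrete .of_discrete]
  rfl

theorem map_neg_right {ρ σ : Measure ℤ} [IsProbabilityMeasure ρ] [IsProbabilityMeasure σ]
    (hσ : σ.map Neg.neg = σ) : (ρ.prod σ).map (fun p => (p.1, -p.2)) = ρ.prod σ := by
  conv_rhs => rw [← hσ]
  conv_rhs => rw [← Measure.map_id (μ := ρ)]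
  rw [Measure.map_prod_map _ _ .of_discrete .of_discrete]
  rfl

theorem two_mul_mul_le_add (a b : ℝ≥0∞) : 2 * (a * b) ≤ a * a + b * b := by
  rcases le_total a b with h | h
  · obtain ⟨c, rfl⟩ := exists_add_of_le h
    calc 2 * (a * (a + c)) ≤ 2 * (a * (a + c)) + c * c := le_self_add
      _ = _ := by ring
  · obtain ⟨c, rfl⟩ := exists_add_of_le h
    calc 2 * ((b + c) * b) ≤ 2 * ((b + c) * b) + c * c := le_self_add
      _ = _ := by ring

/-- For independent copies `a`, `b`, the event `f a = f b + s` is most likely when `s = 0`, by the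
Cauchy–Schwarz inequality. -/
theorem prod_eq_add_le (ρ : Measure ℤ) [IsProbabilityMeasure ρ] (f : ℤ → ℤ) (s : ℤ) :
    (ρ.prod ρ) {p | f p.1 = f p.2 + s} ≤ (ρ.prod ρ) {p | f p.1 = f p.2} := by
  have key (s : ℤ) : (ρ.prod ρ) {p | f p.1 = f p.2 + s} =
      ∑' k : ℤ, ρ (f ⁻¹' {k + s}) * ρ (f ⁻¹' {k}) := by
    have : {p : ℤ × ℤ | f p.1 = f p.2 + s} = ⋃ k : ℤ, (f ⁻¹' {k + s}) ×ˢ (f ⁻¹' {k}) := by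
      ext p; simp
    rw [this, measure_iUnion ?_ fun _ => .of_discrete]
    · simp_rw [Measure.prod_prod]
    · intro i j hij
      refine Set.disjoint_left.2 fun p hp hq => hij ?_
      simp only [Set.mem_prod, Set.mem_preimage, Set.mem_singleton_iff] at hp hq
      omega
  have h0 := key 0
  simp only [add_zero] at h0
  rw [key, h0]
  have shift : ∑' k : ℤ, ρ (f ⁻¹' {k + s}) * ρ (f ⁻¹' {k + s}) =
      ∑' k : ℤ, ρ (f ⁻¹' {k}) * ρ (f ⁻¹' {k}) :=
    (Equiv.addRight s).tsum_eq fun k => ρ (f ⁻¹' {k}) * ρ (f ⁻¹' {k})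
  rw [← ENNReal.mul_le_mul_iff_right (a := 2) (by norm_num) (by norm_num), ← ENNReal.tsum_mul_left]
  calc ∑' k : ℤ, 2 * (ρ (f ⁻¹' {k + s}) * ρ (f ⁻¹' {k}))
      ≤ ∑' k : ℤ, (ρ (f ⁻¹' {k + s}) * ρ (f ⁻¹' {k + s}) + ρ (f ⁻¹' {k}) * ρ (f ⁻¹' {k})) :=
        ENNReal.tsum_le_tsum fun k => two_mul_mul_le_add _ _
    _ = _ := by rw [ENNReal.tsum_add, shift, two_mul]

/-- For the sum of two independent copies of a symmetric variable, the window `[0, j]` is, up to a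
constant factor, the most likely of its translates. -/
theorem conv_self_window_le {ρ : Measure ℤ} [IsProbabilityMeasure ρ] (hρ : ρ.map Neg.neg = ρ)
    (x j : ℤ) : (ρ ∗ ρ) {v | 0 ≤ x + v ∧ x + v ≤ j} ≤ 6 * (ρ ∗ ρ) {v | 0 ≤ v ∧ v ≤ j} := by
  rcases lt_or_ge j 0 with hj | hj
  · have : {v : ℤ | 0 ≤ x + v ∧ x + v ≤ j} = ∅ := by
      ext v; simp only [Set.mem_ofPred_eq, Set.mem_empty_iff_false, iff_false]; omega
    simp [this]
  -- By symmetry, the sum may be replaced with a difference.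
  have hsub (A : Set ℤ) : (ρ ∗ ρ) A = (ρ.prod ρ) {p | p.1 - p.2 ∈ A} := by
    rw [conv_apply_int]
    conv_lhs => rw [← map_neg_right (ρ := ρ) hρ]
    rw [Measure.map_apply .of_discrete .of_discrete]
    rfl
  rw [hsub, hsub]
  simp only [Set.mem_ofPred_eq]
  set L := j + 1 with hL
  have hLpos : 0 < L := by omega
  set c := (-x) / L with hc
  -- The two variables are compared through the blocks of length `L = j + 1` they belong to.
  have hblock : {p : ℤ × ℤ | 0 ≤ x + (p.1 - p.2) ∧ x + (p.1 - p.2) ≤ j} ⊆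
      {p | p.1 / L = p.2 / L + c} ∪ {p | p.1 / L = p.2 / L + (c + 1)} ∪
        {p | p.1 / L = p.2 / L + (c + 2)} := by
    rintro ⟨a, b⟩ ⟨h1, h2⟩
    simp only [Set.mem_union, Set.mem_ofPred_eq] at *
    have ha := Int.mul_ediv_add_emod a L
    have hb := Int.mul_ediv_add_emod b L
    have hx := Int.mul_ediv_add_emod (-x) L
    have ha' := Int.emod_nonneg a hLpos.ne'
    have hb' := Int.emod_nonneg b hLpos.ne'
    have hx' := Int.emod_nonneg (-x) hLpos.ne'
    have ha'' := Int.emod_lt_of_pos a hLpos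
    have hb'' := Int.emod_lt_of_pos b hLpos
    have hx'' := Int.emod_lt_of_pos (-x) hLpos
    rw [← hc] at hx
    set d := a / L - b / L - c with hd
    have hd' : L * d = L * (a / L) - L * (b / L) - L * c := by rw [hd]; ring
    have h3 : -1 < d := by
      by_contra! h
      have : L * d ≤ L * (-1) := by gcongr
      omega
    have h4 : d < 3 := by
      by_contra! h
      have : L * 3 ≤ L * d := by gcongr
      omega
    omega
  have hsame : {p : ℤ × ℤ | p.1 / L = p.2 / L} ⊆
      {p | 0 ≤ p.1 - p.2 ∧ p.1 - p.2 ≤ j} ∪ {p | 0 ≤ p.2 - p.1 ∧ p.2 - p.1 ≤ j} := by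
    rintro ⟨a, b⟩ h
    simp only [Set.mem_union, Set.mem_ofPred_eq] at *
    have ha := Int.mul_ediv_add_emod a L
    have hb := Int.mul_ediv_add_emod b L
    have ha' := Int.emod_nonneg a hLpos.ne'
    have hb' := Int.emod_nonneg b hLpos.ne'
    have ha'' := Int.emod_lt_of_pos a hLpos
    have hb'' := Int.emod_lt_of_pos b hLpos
    rw [h] at ha
    omega
  have hswap : (ρ.prod ρ) {p | 0 ≤ p.2 - p.1 ∧ p.2 - p.1 ≤ j} =
      (ρ.prod ρ) {p | 0 ≤ p.1 - p.2 ∧ p.1 - p.2 ≤ j} := by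
    conv_rhs => rw [← Measure.prod_swap]
    rw [Measure.map_apply .of_discrete .of_discrete]
    rfl
  calc _ ≤ (ρ.prod ρ) {p | p.1 / L = p.2 / L + c} + (ρ.prod ρ) {p | p.1 / L = p.2 / L + (c + 1)}
        + (ρ.prod ρ) {p | p.1 / L = p.2 / L + (c + 2)} :=
        (measure_mono hblock).trans ((measure_union_le _ _).trans
          (add_le_add_left (measure_union_le _ _) _))
    _ ≤ 3 * (ρ.prod ρ) {p | p.1 / L = p.2 / L} := by
        have h (s : ℤ) := prod_eq_add_le ρ (· / L) s
        calc _ ≤ _ := add_le_add (add_le_add (h c) (h (c + 1))) (h (c + 2))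
          _ = _ := by ring
    _ ≤ 3 * ((ρ.prod ρ) {p | 0 ≤ p.1 - p.2 ∧ p.1 - p.2 ≤ j} +
          (ρ.prod ρ) {p | 0 ≤ p.2 - p.1 ∧ p.2 - p.1 ≤ j}) := by
        gcongr
        exact (measure_mono hsame).trans (measure_union_le _ _)
    _ = _ := by rw [hswap]; ring

/-- One more step of the walk does not make the crossing much less likely: the current jump `J` and
the extra jump `J'` are exchangeable and symmetric, so `|J'| ≤ J` and `J'` points towards the
origin with a probability bounded below. -/
theorem crossProb_le_succ (hκ : κ.map Neg.neg = κ) (n : ℕ) :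
    crossProb κ n ≤ 12 * crossProb κ (n + 1) := by
  set ρ := convPow κ n with hρdef
  have hρ : ρ.map Neg.neg = ρ := map_neg_convPow hκ n
  -- The coordinates are the position, the extra jump and the current jump.
  set m := (ρ.prod κ).prod κ with hm
  have h0 : crossProb κ n = m {q | 0 ≤ q.1.1 ∧ q.1.1 ≤ q.1.2} := by
    have : ρ.prod κ = m.map Prod.fst := by simp [hm]
    rw [crossProb, ← hρdef, this, Measure.map_apply .of_discrete .of_discrete]
    rfl
  have h1 : crossProb κ (n + 1) = m {q | 0 ≤ q.1.1 + q.1.2 ∧ q.1.1 + q.1.2 ≤ q.2} := by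
    have : (ρ ∗ κ).prod κ = m.map (fun q => (q.1.1 + q.1.2, q.2)) := by
      have := Measure.map_prod_map (ρ.prod κ) κ (f := fun p => p.1 + p.2) (g := id)
        .of_discrete .of_discrete
      rw [Measure.map_id] at this
      exact this
    rw [crossProb, convPow, this, Measure.map_apply .of_discrete .of_discrete]
    rfl
  have hpt (a b c : ℤ) : m {((a, b), c)} = ρ {a} * κ {b} * κ {c} := by
    rw [hm, ← Set.singleton_prod_singleton, ← Set.singleton_prod_singleton, Measure.prod_prod,
      Measure.prod_prod]
  have hneg {σ : Measure ℤ} (hσ : σ.map Neg.neg = σ) (a : ℤ) : σ {-a} = σ {a} := by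
    conv_rhs => rw [← hσ]
    rw [Measure.map_apply .of_discrete .of_discrete]
    congr 1
    ext z
    simp
  have inv (T : (ℤ × ℤ) × ℤ → (ℤ × ℤ) × ℤ) (hT : Function.Involutive T)
      (h : ∀ q, m {T q} = m {q}) (A : Set ((ℤ × ℤ) × ℤ)) : m (T ⁻¹' A) = m A := by
    rw [← Measure.map_apply .of_discrete .of_discrete]
    congr 1
    refine Measure.ext_of_singleton fun q => ?_
    rw [Measure.map_apply .of_discrete .of_discrete, ← h q]
    congr 1
    ext z
    simp only [Set.mem_preimage, Set.mem_singleton_iff]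
    exact ⟨fun h => by rw [← h, hT], fun h => by rw [h, hT]⟩
  -- The law `m` is invariant under the exchange of the two jumps and under sign changes.
  have swap := inv (fun q => ((q.1.1, q.2), q.1.2)) (fun q => rfl)
    fun ⟨⟨a, b⟩, c⟩ => by rw [hpt, hpt]; ring
  have flip := inv (fun q => ((q.1.1, -q.1.2), q.2)) (fun q => by simp)
    fun ⟨⟨a, b⟩, c⟩ => by rw [hpt, hpt, hneg hκ]
  have flip2 := inv (fun q => ((-q.1.1, -q.1.2), q.2)) (fun q => by simp)
    fun ⟨⟨a, b⟩, c⟩ => by rw [hpt, hpt, hneg hκ, hneg hρ]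
  have toJ : crossProb κ n = m {q | 0 ≤ q.1.1 ∧ q.1.1 ≤ q.2} := by rw [h0, ← swap]; rfl
  have e1 : m {q | 0 ≤ q.1.1 ∧ q.1.1 ≤ q.2 ∧ q.2 < -q.1.2} =
      m {q | 0 ≤ q.1.1 ∧ q.1.1 ≤ q.2 ∧ q.2 < q.1.2} := by rw [← flip]; simp
  have e2 : m {q | 0 ≤ q.1.1 ∧ q.1.1 ≤ q.2 ∧ q.2 < q.1.2} =
      m {q | 0 ≤ q.1.1 ∧ q.1.1 ≤ q.1.2 ∧ q.1.2 < q.2} := by rw [← swap]; rfl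
  have e3 : m {q | 0 ≤ q.1.1 ∧ q.1.1 ≤ q.2 ∧ 0 ≤ q.1.2 ∧ q.1.2 ≤ q.2} =
      m {q | 0 ≤ q.1.1 ∧ q.1.1 ≤ q.2 ∧ q.1.2 ≤ 0 ∧ -q.1.2 ≤ q.2} := by rw [← flip]; simp
  have e4 : m {q | 0 ≤ -q.1.1 + -q.1.2 ∧ -q.1.1 + -q.1.2 ≤ q.2} = crossProb κ (n + 1) := by
    rw [h1, ← flip2]
    congr 1
    ext q
    simp only [Set.mem_preimage, Set.mem_ofPred_eq, neg_neg]
  -- If the extra jump is the larger one in absolute value, the two jumps are exchanged.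
  have s1 : m {q | 0 ≤ q.1.1 ∧ q.1.1 ≤ q.2} ≤
      m {q | 0 ≤ q.1.1 ∧ q.1.1 ≤ q.2 ∧ -q.2 ≤ q.1.2 ∧ q.1.2 ≤ q.2} +
        (m {q | 0 ≤ q.1.1 ∧ q.1.1 ≤ q.2 ∧ q.2 < q.1.2} +
          m {q | 0 ≤ q.1.1 ∧ q.1.1 ≤ q.2 ∧ q.2 < -q.1.2}) := by
    refine (measure_mono ?_).trans ((measure_union_le _ _).trans
      (add_le_add_right (measure_union_le _ _) _))
    rintro ⟨⟨a, b⟩, c⟩ h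
    simp only [Set.mem_union, Set.mem_ofPred_eq] at *
    omega
  have s2 : m {q | 0 ≤ q.1.1 ∧ q.1.1 ≤ q.1.2 ∧ q.1.2 < q.2} ≤
      m {q | 0 ≤ q.1.1 ∧ q.1.1 ≤ q.2 ∧ -q.2 ≤ q.1.2 ∧ q.1.2 ≤ q.2} := by
    refine measure_mono ?_
    rintro ⟨⟨a, b⟩, c⟩ h
    simp only [Set.mem_ofPred_eq] at *
    omega
  have s3 : m {q | 0 ≤ q.1.1 ∧ q.1.1 ≤ q.2 ∧ -q.2 ≤ q.1.2 ∧ q.1.2 ≤ q.2} ≤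
      m {q | 0 ≤ q.1.1 ∧ q.1.1 ≤ q.2 ∧ 0 ≤ q.1.2 ∧ q.1.2 ≤ q.2} +
        m {q | 0 ≤ q.1.1 ∧ q.1.1 ≤ q.2 ∧ q.1.2 ≤ 0 ∧ -q.1.2 ≤ q.2} := by
    refine (measure_mono ?_).trans (measure_union_le _ _)
    rintro ⟨⟨a, b⟩, c⟩ h
    simp only [Set.mem_union, Set.mem_ofPred_eq] at *
    omega
  -- A small extra jump towards the origin lands on one side of it or on the other one.
  have s4 : m {q | 0 ≤ q.1.1 ∧ q.1.1 ≤ q.2 ∧ q.1.2 ≤ 0 ∧ -q.1.2 ≤ q.2} ≤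
      m {q | 0 ≤ q.1.1 + q.1.2 ∧ q.1.1 + q.1.2 ≤ q.2} +
        m {q | 0 ≤ -q.1.1 + -q.1.2 ∧ -q.1.1 + -q.1.2 ≤ q.2} := by
    refine (measure_mono ?_).trans (measure_union_le _ _)
    rintro ⟨⟨a, b⟩, c⟩ h
    simp only [Set.mem_union, Set.mem_ofPred_eq] at *
    omega
  rw [e1, e2] at s1
  rw [e3] at s3
  rw [e4, ← h1] at s4
  rw [toJ]
  calc _ ≤ _ := s1
    _ ≤ _ := add_le_add_right (add_le_add s2 s2) _
    _ = 3 * m {q | 0 ≤ q.1.1 ∧ q.1.1 ≤ q.2 ∧ -q.2 ≤ q.1.2 ∧ q.1.2 ≤ q.2} := by ring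
    _ ≤ 3 * (2 * (crossProb κ (n + 1) + crossProb κ (n + 1))) := by
        gcongr
        refine s3.trans ?_
        rw [two_mul]
        exact add_le_add s4 s4
    _ = _ := by ring

/-- After an even number of steps, the position is the sum of two independent copies of a symmetric
variable. -/
theorem shifted_crossProb_even_le (hκ : κ.map Neg.neg = κ) (n : ℕ) (x : ℤ) :
    ((convPow κ (n + n)).prod κ) {p | 0 ≤ x + p.1 ∧ x + p.1 ≤ p.2} ≤
      6 * crossProb κ (n + n) := by
  rw [crossProb, Measure.prod_apply_symm .of_discrete, Measure.prod_apply_symm .of_discrete,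
    ← lintegral_const_mul _ .of_discrete, convPow_add]
  exact lintegral_mono fun j => conv_self_window_le (map_neg_convPow hκ n) x j

/-- A bound which is uniform in the starting point is inherited by the next step of the walk. -/
theorem shifted_crossProb_succ_le (n : ℕ) (B : ℝ≥0∞)
    (hB : ∀ x, ((convPow κ n).prod κ) {p | 0 ≤ x + p.1 ∧ x + p.1 ≤ p.2} ≤ B) (x : ℤ) :
    ((convPow κ (n + 1)).prod κ) {p | 0 ≤ x + p.1 ∧ x + p.1 ≤ p.2} ≤ B := by
  have : convPow κ (n + 1) = κ ∗ convPow κ n := by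
    rw [convPow, Measure.conv_comm]
  rw [this, Measure.conv, Measure.prod_apply_symm .of_discrete]
  calc ∫⁻ j, _ ∂κ = ∫⁻ j, ∫⁻ y, convPow κ n {v | 0 ≤ (x + y) + v ∧ (x + y) + v ≤ j} ∂κ ∂κ :=
        lintegral_congr fun j => by
          rw [Measure.map_apply .of_discrete .of_discrete, Measure.prod_apply .of_discrete]
          simp only [add_assoc]
          rfl
    _ = ∫⁻ y, ∫⁻ j, convPow κ n {v | 0 ≤ (x + y) + v ∧ (x + y) + v ≤ j} ∂κ ∂κ :=
        lintegral_lintegral_swap (Measurable.of_discrete.aemeasurable)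
    _ = ∫⁻ y, ((convPow κ n).prod κ) {p | 0 ≤ (x + y) + p.1 ∧ (x + y) + p.1 ≤ p.2} ∂κ :=
        lintegral_congr fun y => by
          rw [Measure.prod_apply_symm .of_discrete]
          rfl
    _ ≤ ∫⁻ _, B ∂κ := lintegral_mono fun y => hB (x + y)
    _ = B := by simp

/-- Up to a constant factor, the crossing probability is maximal for a walk started at the
origin. -/
theorem shifted_crossProb_le (hκ : κ.map Neg.neg = κ) (n : ℕ) (x : ℤ) :
    ((convPow κ n).prod κ) {p | 0 ≤ x + p.1 ∧ x + p.1 ≤ p.2} ≤ 72 * crossProb κ n := by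
  rcases Nat.even_or_odd' n with ⟨k, rfl | rfl⟩
  · rw [two_mul]
    refine (shifted_crossProb_even_le hκ k x).trans ?_
    gcongr
    norm_num
  · rw [two_mul]
    refine (shifted_crossProb_succ_le _ _ (shifted_crossProb_even_le hκ k) x).trans ?_
    calc 6 * crossProb κ (k + k) ≤ 6 * (12 * crossProb κ (k + k + 1)) := by
          gcongr; exact crossProb_le_succ hκ _
      _ = _ := by ring

theorem crossProb_succ_le (hκ : κ.map Neg.neg = κ) (n : ℕ) :
    crossProb κ (n + 1) ≤ 72 * crossProb κ n := by
  simpa [crossProb] using shifted_crossProb_succ_le n _ (shifted_crossProb_le hκ n) 0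

end Symmetric

/-! ### Second moments of the crossing events -/

/-- A form of the Kochen–Stone lemma: if the probabilities of the events `A n` have a divergent
series and the pairwise correlations are controlled by a sequence `b` whose partial sums are of the
same order as those of the series, then infinitely many `A n` occur with positive probability. -/
theorem measure_limsup_ne_zero_of_correlation {Ω : Type*} [MeasurableSpace Ω] {P : Measure Ω}
    [IsProbabilityMeasure P] {A : ℕ → Set Ω} (hA : ∀ n, MeasurableSet (A n))
    (hsum : ∑' n, P (A n) = ∞) (b : ℕ → ℝ≥0∞)
    (hpair : ∀ m n, m < n → P (A m ∩ A n) ≤ P (A m) * b (n - m - 1))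
    (C : ℝ≥0∞) (hC : C ≠ ∞)
    (hb : ∀ N, ∑ k ∈ Finset.range N, b k ≤ C * ∑ k ∈ Finset.range (N + 1), P (A k)) :
    P (limsup A atTop) ≠ 0 := by
  set M : ℝ≥0∞ := 1 + 2 * C with hM
  have hMtop : M ≠ ∞ := by finiteness
  have hM0 : M ≠ 0 := by simp [hM]
  have key (K : ℕ) : (2 * M)⁻¹ < P (⋃ n ≥ K, A n) := by
    set E : Set Ω := ⋃ n ≥ K, A n with hE
    -- The interval `[K, N)` is chosen so that the tail sum `s` dominates the lower order terms.
    obtain ⟨N, hKN, hN⟩ : ∃ N, K ≤ N ∧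
        1 + 2 * C * (K + 1) ≤ ∑ n ∈ Finset.Ico K N, P (A n) := by
      have h1 := (ENNReal.summable (f := fun n => P (A n))).hasSum.tendsto_sum_nat
      rw [hsum] at h1
      have hfin : K + (1 + 2 * C * (K + 1)) < ∞ := by finiteness
      obtain ⟨N, hN, hKN⟩ := ((h1.eventually (lt_mem_nhds hfin)).and (eventually_ge_atTop K)).exists
      refine ⟨N, hKN, ?_⟩
      rw [← Finset.sum_range_add_sum_Ico _ hKN] at hN
      have h2 : ∑ n ∈ Finset.range K, P (A n) ≤ K :=
        (Finset.sum_le_card_nsmul _ _ 1 fun n _ => prob_le_one).trans (by simp)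
      have := hN.le.trans (add_le_add_left h2 _)
      exact (ENNReal.add_le_add_iff_left (by finiteness)).1 this
    set s := ∑ n ∈ Finset.Ico K N, P (A n) with hs
    have hs_top : s ≠ ∞ := (ENNReal.sum_lt_top.2 fun n _ => measure_lt_top _ _).ne
    have hs0 : s ≠ 0 := fun h => by simp [h] at hN
    set f : Ω → ℝ≥0∞ := fun ω => ∑ n ∈ Finset.Ico K N, (A n).indicator 1 ω with hf
    have hfm : Measurable f :=
      Finset.measurable_fun_sum _ fun n _ => measurable_one.indicator (hA n)
    have hf1 : ∫⁻ ω, f ω ∂P = s := by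
      rw [lintegral_finsetSum _ fun n _ => measurable_one.indicator (hA n)]
      exact Finset.sum_congr rfl fun n _ => lintegral_indicator_one (hA n)
    have hf2 : ∫⁻ ω, f ω * f ω ∂P =
        ∑ m ∈ Finset.Ico K N, ∑ n ∈ Finset.Ico K N, P (A m ∩ A n) := by
      simp only [hf, Finset.sum_mul_sum]
      have hmn (m n : ℕ) :
          Measurable fun ω => (A m).indicator (1 : Ω → ℝ≥0∞) ω * (A n).indicator 1 ω :=
        (measurable_one.indicator (hA m)).mul (measurable_one.indicator (hA n))
      rw [lintegral_finsetSum _ fun m _ => Finset.measurable_fun_sum _ fun n _ => hmn m n]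
      refine Finset.sum_congr rfl fun m _ => ?_
      rw [lintegral_finsetSum _ fun n _ => hmn m n]
      refine Finset.sum_congr rfl fun n _ => ?_
      rw [← lintegral_indicator_one ((hA m).inter (hA n))]
      refine lintegral_congr fun ω => ?_
      rw [Set.inter_indicator_one]
      rfl
    have hB : ∑ k ∈ Finset.range N, b k ≤ C * (K + 1 + s) := by
      refine (hb N).trans ?_
      gcongr
      rw [Finset.sum_range_succ, ← Finset.sum_range_add_sum_Ico _ hKN]
      have h2 : ∑ n ∈ Finset.range K, P (A n) ≤ K :=
        (Finset.sum_le_card_nsmul _ _ 1 fun n _ => prob_le_one).trans (by simp)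
      calc _ ≤ K + s + 1 := by gcongr; exact prob_le_one
        _ = _ := by ring
    have hin (m : ℕ) : ∑ n ∈ Finset.Ico K N, (if m < n then b (n - m - 1) else 0) ≤
        ∑ k ∈ Finset.range N, b k := by
      rw [← Finset.sum_filter]
      have hinj : Set.InjOn (fun n => n - m - 1)
          (({n ∈ Finset.Ico K N | m < n} : Finset ℕ) : Set ℕ) := by
        intro i hi j hj hij
        simp only [Finset.coe_filter, Finset.mem_Ico, Set.mem_ofPred_eq] at hi hj hij
        omega
      rw [← Finset.sum_image (f := b) (g := fun n => n - m - 1) hinj]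
      refine Finset.sum_le_sum_of_subset fun k hk => ?_
      simp only [Finset.mem_image, Finset.mem_filter, Finset.mem_Ico, Finset.mem_range] at hk ⊢
      omega
    have hpair' (m n : ℕ) : P (A m ∩ A n) ≤ (if m = n then P (A m) else 0) +
        (P (A m) * (if m < n then b (n - m - 1) else 0) +
          P (A n) * (if n < m then b (m - n - 1) else 0)) := by
      rcases lt_trichotomy m n with h | h | h
      · simpa [h, h.ne, h.not_gt] using hpair m n h
      · subst h; simp
      · rw [Set.inter_comm]
        simpa [h, h.ne', h.not_gt] using hpair n m h
    -- The pairs with `m < n` and those with `n < m` contribute the same amount.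
    have hf2' : ∫⁻ ω, f ω * f ω ∂P ≤ M * s * s := by
      have hoff : ∑ m ∈ Finset.Ico K N, ∑ n ∈ Finset.Ico K N,
          P (A m) * (if m < n then b (n - m - 1) else 0) ≤ s * (C * (K + 1 + s)) := by
        rw [hs, Finset.sum_mul]
        refine Finset.sum_le_sum fun m _ => ?_
        rw [← Finset.mul_sum]
        gcongr
        exact (hin m).trans hB
      calc _ ≤ _ := hf2.le.trans (Finset.sum_le_sum fun m _ => Finset.sum_le_sum fun n _ =>
            hpair' m n)
        _ = s + (∑ m ∈ Finset.Ico K N, ∑ n ∈ Finset.Ico K N,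
              P (A m) * (if m < n then b (n - m - 1) else 0) +
            ∑ m ∈ Finset.Ico K N, ∑ n ∈ Finset.Ico K N,
              P (A m) * (if m < n then b (n - m - 1) else 0)) := by
            simp only [Finset.sum_add_distrib]
            congr 1
            · refine Finset.sum_congr rfl fun m hm => ?_
              rw [Finset.sum_ite_eq, if_pos hm]
            · congr 1
              rw [Finset.sum_comm]
        _ ≤ s + (s * (C * (K + 1 + s)) + s * (C * (K + 1 + s))) := by gcongr
        _ = s * (1 + 2 * C * (K + 1)) + 2 * C * s * s := by ring
        _ ≤ s * s + 2 * C * s * s := by gcongr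
        _ = _ := by rw [hM]; ring
    have hEm : MeasurableSet E := .iUnion fun n => .iUnion fun _ => hA n
    -- This pointwise form of the Cauchy–Schwarz inequality makes the second moment bound `P E`.
    have hpt (ω : Ω) : 4 * M * s * f ω ≤ 4 * M * M * s * s * E.indicator 1 ω + f ω * f ω := by
      by_cases hω : ω ∈ E
      · rw [Set.indicator_of_mem hω]
        calc _ = 2 * ((2 * M * s) * f ω) := by ring
          _ ≤ _ := two_mul_mul_le_add _ _
          _ = _ := by simp only [Pi.one_apply]; ring
      · have : f ω = 0 := Finset.sum_eq_zero fun n hn => by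
          refine Set.indicator_of_notMem (fun h => hω ?_) _
          simp only [hE, Set.mem_iUnion]
          exact ⟨n, (Finset.mem_Ico.1 hn).1, h⟩
        simp [this]
    have hint : 4 * M * s * s ≤ 4 * M * M * s * s * P E + M * s * s := by
      calc 4 * M * s * s = ∫⁻ ω, 4 * M * s * f ω ∂P := by rw [lintegral_const_mul _ hfm, hf1]
        _ ≤ ∫⁻ ω, (4 * M * M * s * s * E.indicator 1 ω + f ω * f ω) ∂P := lintegral_mono hpt
        _ = 4 * M * M * s * s * P E + ∫⁻ ω, f ω * f ω ∂P := by
            have hff : Measurable fun ω => f ω * f ω := hfm.mul hfm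
            rw [lintegral_add_right _ hff,
              lintegral_const_mul _ (measurable_one.indicator hEm), lintegral_indicator_one hEm]
        _ ≤ _ := by gcongr
    by_contra! hcon
    have h3 : 4 * M * M * s * s * P E ≤ 2 * M * s * s := by
      calc _ ≤ 4 * M * M * s * s * (2 * M)⁻¹ := by gcongr
        _ = 2 * M * s * s * ((2 * M) * (2 * M)⁻¹) := by ring
        _ = _ := by rw [ENNReal.mul_inv_cancel (by simp [hM0]) (by finiteness), mul_one]
    have h4 : 3 * (M * s * s) + M * s * s ≤ 3 * (M * s * s) + 0 := by
      calc _ = 4 * M * s * s := by ring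
        _ ≤ _ := hint.trans (add_le_add_left h3 _)
        _ = _ := by ring
    have h5 := (ENNReal.add_le_add_iff_left (by finiteness)).1 h4
    simp [hM0, hs0] at h5
  have hlim : Tendsto (fun K => P (⋃ n ≥ K, A n)) atTop (nhds (P (limsup A atTop))) := by
    rw [limsup_eq_iInf_iSup_of_nat]
    simp only [Set.iSup_eq_iUnion, Set.iInf_eq_iInter]
    refine tendsto_measure_iInter_atTop
      (fun K => (MeasurableSet.iUnion fun n => .iUnion fun _ => hA n).nullMeasurableSet)
      (fun K L h => ?_) ⟨0, measure_ne_top _ _⟩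
    exact Set.iUnion_mono fun n => Set.iUnion_mono' fun hn => ⟨h.trans hn, subset_rfl⟩
  have := ge_of_tendsto' hlim fun K => (key K).le
  intro h
  rw [h] at this
  simp only [nonpos_iff_eq_zero, ENNReal.inv_eq_zero] at this
  exact absurd this (by finiteness)

theorem prod_neg_left_apply {ρ σ : Measure ℤ} [IsProbabilityMeasure ρ] [IsProbabilityMeasure σ]
    (hρ : ρ.map Neg.neg = ρ) (A : Set (ℤ × ℤ)) :
    (ρ.prod σ) ((fun p => (-p.1, p.2)) ⁻¹' A) = (ρ.prod σ) A := by
  rw [← Measure.map_apply .of_discrete .of_discrete, map_neg_left hρ]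

theorem prod_neg_right_apply {ρ σ : Measure ℤ} [IsProbabilityMeasure ρ] [IsProbabilityMeasure σ]
    (hσ : σ.map Neg.neg = σ) (A : Set (ℤ × ℤ)) :
    (ρ.prod σ) ((fun p => (p.1, -p.2)) ⁻¹' A) = (ρ.prod σ) A := by
  rw [← Measure.map_apply .of_discrete .of_discrete, map_neg_right hσ]

section IID

variable {Ω : Type*} [MeasurableSpace Ω] {P : Measure Ω} [IsProbabilityMeasure P]
  {κ : Measure ℤ} {ξ : ℕ → Ω → ℤ}

theorem indepFun_sum_range {P : Measure Ω} (hm : ∀ i, Measurable (ξ i)) (hξ : iIndepFun ξ P) (n : ℕ) :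
    IndepFun (fun ω => ∑ i ∈ Finset.range n, ξ i ω) (ξ n) P := by
  have := hξ.indepFun_sum_range_succ hm n
  rwa [show ∑ j ∈ Finset.range n, ξ j = fun ω => ∑ i ∈ Finset.range n, ξ i ω by ext; simp] at this

theorem map_sum_range_eq_convPow (hm : ∀ i, Measurable (ξ i)) (hξ : iIndepFun ξ P)
    (hlaw : ∀ i, P.map (ξ i) = κ) (n : ℕ) :
    P.map (fun ω => ∑ i ∈ Finset.range n, ξ i ω) = convPow κ n := by
  induction n with
  | zero => simp [convPow, Measure.map_const]
  | succ n ih =>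
    have := (indepFun_sum_range hm hξ n).map_add_eq_map_conv_map
      (Finset.measurable_fun_sum _ fun i _ => hm i) (hm n)
    rw [hlaw, ih] at this
    rw [convPow, ← this]
    congr 1
    ext ω
    simp [Finset.sum_range_succ]

theorem map_sum_range_prodMk (hm : ∀ i, Measurable (ξ i)) (hξ : iIndepFun ξ P)
    (hlaw : ∀ i, P.map (ξ i) = κ) (n : ℕ) :
    P.map (fun ω => (∑ i ∈ Finset.range n, ξ i ω, ξ n ω)) = (convPow κ n).prod κ := by
  rw [(indepFun_iff_map_prod_eq_prod_map_map
    (Finset.measurable_fun_sum _ fun i _ => hm i).aemeasurable (hm n).aemeasurable).1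
    (indepFun_sum_range hm hξ n), hlaw, map_sum_range_eq_convPow hm hξ hlaw]

/-- By independence and stationarity, the returns to the origin at the times `a` and `a + k` are
those of two independent walks. -/
theorem measure_sum_range_eq_zero_inter (hm : ∀ i, Measurable (ξ i)) (hξ : iIndepFun ξ P)
    (hlaw : ∀ i, P.map (ξ i) = κ) (a k : ℕ) :
    P {ω | ∑ i ∈ Finset.range a, ξ i ω = 0 ∧ ∑ i ∈ Finset.range (a + k), ξ i ω = 0} =
      convPow κ a {0} * convPow κ k {0} := by
  have hind : IndepFun (fun ω => ∑ i ∈ Finset.range a, ξ i ω)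
      (fun ω => ∑ i ∈ Finset.range k, ξ (a + i) ω) P := by
    have h := hξ.indepFun_finset (Finset.range a) (Finset.Ico a (a + k))
      (Finset.disjoint_left.2 fun i hi hj => by simp at hi hj; omega) hm
    have := h.comp (φ := fun x => ∑ i, x i) (ψ := fun x => ∑ i, x i)
      (Finset.measurable_fun_sum _ fun i _ => measurable_pi_apply i)
      (Finset.measurable_fun_sum _ fun i _ => measurable_pi_apply i)
    convert! this using 1
    · ext ω
      exact (Finset.sum_coe_sort (Finset.range a) fun i => ξ i ω).symm
    · ext ω
      rw [Function.comp_apply, Finset.sum_coe_sort (Finset.Ico a (a + k)) fun i => ξ i ω,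
        Finset.sum_Ico_eq_sum_range, Nat.add_sub_cancel_left]
  have h1 := map_sum_range_eq_convPow hm hξ hlaw a
  have h2 := map_sum_range_eq_convPow (fun i => hm (a + i))
    (hξ.precomp (g := fun i => a + i) fun i j h => by simpa using h) (fun i => hlaw _) k
  have hm1 : Measurable fun ω => ∑ i ∈ Finset.range a, ξ i ω :=
    Finset.measurable_fun_sum _ fun i _ => hm i
  have hm2 : Measurable fun ω => ∑ i ∈ Finset.range k, ξ (a + i) ω :=
    Finset.measurable_fun_sum _ fun i _ => hm _
  rw [← h1, ← h2, Measure.map_apply hm1 .of_discrete, Measure.map_apply hm2 .of_discrete,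
    ← hind.measure_inter_preimage_eq_mul _ _ .of_discrete .of_discrete]
  congr 1
  ext ω
  simp only [Set.mem_ofPred_eq, Set.mem_inter_iff, Set.mem_preimage, Set.mem_singleton_iff,
    Finset.sum_range_add]
  omega

/-- The crossing events at the times `m` and `m + 1 + k`: whatever happens up to the first one, the
second one is not much more likely than for a walk started afresh. -/
theorem measure_crossing_inter_le [IsProbabilityMeasure κ] (hκ : κ.map Neg.neg = κ)
    (hm : ∀ i, Measurable (ξ i)) (hξ : iIndepFun ξ P) (hlaw : ∀ i, P.map (ξ i) = κ) (m k : ℕ) :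
    P {ω | (0 ≤ -∑ i ∈ Finset.range m, ξ i ω ∧ -∑ i ∈ Finset.range m, ξ i ω ≤ ξ m ω) ∧
        0 ≤ -∑ i ∈ Finset.range (m + 1 + k), ξ i ω ∧
          -∑ i ∈ Finset.range (m + 1 + k), ξ i ω ≤ ξ (m + 1 + k) ω} ≤
      crossProb κ m * (72 * crossProb κ k) := by
  set f : Ω → ℤ × ℤ := fun ω => (∑ i ∈ Finset.range m, ξ i ω, ξ m ω) with hf
  set g : Ω → ℤ × ℤ := fun ω => (∑ i ∈ Finset.range k, ξ (m + 1 + i) ω, ξ (m + 1 + k) ω) with hg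
  have hfm : Measurable f := (Finset.measurable_fun_sum _ fun i _ => hm i).prodMk (hm m)
  have hgm : Measurable g := (Finset.measurable_fun_sum _ fun i _ => hm _).prodMk (hm _)
  have hind : IndepFun f g P := by
    have h := hξ.indepFun_finset (Finset.range (m + 1)) (Finset.Ico (m + 1) (m + 1 + k + 1))
      (Finset.disjoint_left.2 fun i hi hj => by simp at hi hj; omega) hm
    have := h.comp
      (φ := fun x => (∑ i ∈ (Finset.range m).attach, x ⟨i.1, by have := Finset.mem_range.1 i.2; simp; omega⟩,
        x ⟨m, by simp⟩))
      (ψ := fun x => (∑ i ∈ (Finset.range k).attach,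
        x ⟨m + 1 + i.1, by have := Finset.mem_range.1 i.2; simp; omega⟩, x ⟨m + 1 + k, by simp⟩))
      (by fun_prop) (by fun_prop)
    convert! this using 1
    · ext ω
      · exact (Finset.sum_attach (Finset.range m) fun i => ξ i ω).symm
      · rfl
    · ext ω
      · exact (Finset.sum_attach (Finset.range k) fun i => ξ (m + 1 + i) ω).symm
      · rfl
  have hmap := (indepFun_iff_map_prod_eq_prod_map_map hfm.aemeasurable hgm.aemeasurable).1 hind
  rw [map_sum_range_prodMk hm hξ hlaw m, map_sum_range_prodMk (fun i => hm (m + 1 + i))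
    (hξ.precomp (g := fun i => m + 1 + i) fun i j h => by simpa using h) (fun i => hlaw _) k]
    at hmap
  set B : Set (ℤ × ℤ) := {p | 0 ≤ -p.1 ∧ -p.1 ≤ p.2} with hB
  have hBprob : ((convPow κ m).prod κ) B = crossProb κ m := by
    exact prod_neg_left_apply (map_neg_convPow hκ m) {p | 0 ≤ p.1 ∧ p.1 ≤ p.2}
  have hset : {ω | (0 ≤ -∑ i ∈ Finset.range m, ξ i ω ∧ -∑ i ∈ Finset.range m, ξ i ω ≤ ξ m ω) ∧
        0 ≤ -∑ i ∈ Finset.range (m + 1 + k), ξ i ω ∧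
          -∑ i ∈ Finset.range (m + 1 + k), ξ i ω ≤ ξ (m + 1 + k) ω} =
      (fun ω => (f ω, g ω)) ⁻¹' {p | p.1 ∈ B ∧ 0 ≤ -(p.1.1 + p.1.2) - p.2.1 ∧
        -(p.1.1 + p.1.2) - p.2.1 ≤ p.2.2} := by
    ext ω
    simp only [hf, hg, hB, Set.mem_ofPred_eq, Set.mem_preimage, Finset.sum_range_add,
      Finset.sum_range_one, add_zero]
    omega
  rw [hset, ← Measure.map_apply (hfm.prodMk hgm) .of_discrete, hmap,
    Measure.prod_apply .of_discrete]
  calc ∫⁻ p, _ ∂((convPow κ m).prod κ) ≤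
        ∫⁻ p, (72 * crossProb κ k) * B.indicator 1 p ∂((convPow κ m).prod κ) := by
        refine lintegral_mono fun p => ?_
        by_cases hp : p ∈ B
        · simp only [Set.preimage_ofPred_eq, hp, true_and, Set.indicator_of_mem, Pi.one_apply,
            mul_one]
          refine le_trans (le_of_eq ?_) (shifted_crossProb_le hκ k (-(p.1 + p.2)))
          simp only [sub_eq_add_neg]
          exact prod_neg_left_apply (map_neg_convPow hκ k)
            {q | 0 ≤ -(p.1 + p.2) + q.1 ∧ -(p.1 + p.2) + q.1 ≤ q.2}
        · simp [hp]
    _ = _ := by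
        rw [lintegral_const_mul _ .of_discrete, lintegral_indicator_one .of_discrete, hBprob,
          mul_comm]

end IID

/-- Two independent walks `X`, `Y` with symmetric jumps `ξ`, `η`: if the probabilities that `X` is
at the origin while `Y` jumps over it have a divergent series, then this happens infinitely often
with positive probability. The delay `d ≤ 1` tells whether `X` jumps before `Y` or after it. -/
theorem measure_limsup_crossing_ne_zero {Ω : Type*} [MeasurableSpace Ω] {P : Measure Ω}
    [IsProbabilityMeasure P] {κ₁ κ₂ : Measure ℤ} [IsProbabilityMeasure κ₁]
    [IsProbabilityMeasure κ₂] (hκ₂ : κ₂.map Neg.neg = κ₂) {ξ η : ℕ → Ω → ℤ}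
    (hξm : ∀ i, Measurable (ξ i)) (hξ : iIndepFun ξ P) (hξlaw : ∀ i, P.map (ξ i) = κ₁)
    (hηm : ∀ i, Measurable (η i)) (hη : iIndepFun η P) (hηlaw : ∀ i, P.map (η i) = κ₂)
    (hind : IndepFun (fun ω i => ξ i ω) (fun ω i => η i ω) P) (d : ℕ) (hd : d ≤ 1)
    (hsum : ∑' n, convPow κ₁ (n + 1) {0} * crossProb κ₂ n = ∞) :
    P (limsup (fun n => {ω | ∑ i ∈ Finset.range (n + d), ξ i ω = 0 ∧
      0 ≤ -∑ i ∈ Finset.range n, η i ω ∧ -∑ i ∈ Finset.range n, η i ω ≤ η n ω}) atTop) ≠ 0 := by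
  have hX (n : ℕ) : Measurable fun x : ℕ → ℤ => ∑ i ∈ Finset.range n, x i :=
    Finset.measurable_fun_sum _ fun i _ => measurable_pi_apply i
  have hcross (n : ℕ) : MeasurableSet {x : ℕ → ℤ | 0 ≤ -∑ i ∈ Finset.range n, x i ∧
      -∑ i ∈ Finset.range n, x i ≤ x n} :=
    (measurableSet_le measurable_const (hX n).neg).inter
      (measurableSet_le (hX n).neg (measurable_pi_apply n))
  have hzero (n : ℕ) : MeasurableSet {x : ℕ → ℤ | ∑ i ∈ Finset.range n, x i = 0} :=
    measurableSet_eq_fun (hX n) measurable_const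
  have hξm' : Measurable fun ω i => ξ i ω := measurable_pi_lambda _ hξm
  have hηm' : Measurable fun ω i => η i ω := measurable_pi_lambda _ hηm
  have hprob (n : ℕ) : P {ω | ∑ i ∈ Finset.range (n + d), ξ i ω = 0 ∧
      0 ≤ -∑ i ∈ Finset.range n, η i ω ∧ -∑ i ∈ Finset.range n, η i ω ≤ η n ω} =
      convPow κ₁ (n + d) {0} * crossProb κ₂ n := by
    have := hind.measure_inter_preimage_eq_mul _ _ (hzero (n + d)) (hcross n)
    refine this.trans ?_
    congr 1
    · rw [← map_sum_range_eq_convPow hξm hξ hξlaw, Measure.map_apply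
        (Finset.measurable_fun_sum _ fun i _ => hξm i) .of_discrete]
      rfl
    · rw [crossProb, ← map_neg_left (map_neg_convPow hκ₂ n),
        ← map_sum_range_prodMk hηm hη hηlaw, Measure.map_map .of_discrete
          ((Finset.measurable_fun_sum _ fun i _ => hηm i).prodMk (hηm n)),
        Measure.map_apply (Measurable.of_discrete.comp
          ((Finset.measurable_fun_sum _ fun i _ => hηm i).prodMk (hηm n))) .of_discrete]
      rfl
  -- For `d = 0` the crossing of the other walk occurs one step later than in the series.
  have hcmp (n : ℕ) : convPow κ₁ (n + 1) {0} * crossProb κ₂ n ≤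
      12 * (convPow κ₁ (n + 1) {0} * crossProb κ₂ (n + 1)) := by
    calc _ ≤ convPow κ₁ (n + 1) {0} * (12 * crossProb κ₂ (n + 1)) := by
          gcongr; exact crossProb_le_succ hκ₂ n
      _ = _ := by ring
  refine measure_limsup_ne_zero_of_correlation (fun n => ?_) ?_
    (fun k => 72 * (convPow κ₁ (k + 1) {0} * crossProb κ₂ k)) ?_ (72 * 12) (by finiteness) ?_
  · exact (hξm' (hzero (n + d))).inter (hηm' (hcross n))
  · simp_rw [hprob]
    interval_cases d
    · have h := ENNReal.tsum_le_tsum hcmp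
      rw [hsum, ENNReal.tsum_mul_left, top_le_iff] at h
      have h' : ∑' n, convPow κ₁ (n + 1) {0} * crossProb κ₂ (n + 1) = ∞ := by
        by_contra hne
        exact ENNReal.mul_ne_top (by norm_num) hne h
      rw [tsum_eq_zero_add' ENNReal.summable]
      simp only [add_zero] at h' ⊢
      rw [h', add_top]
    · exact hsum
  · intro m n hmn
    obtain ⟨k, rfl⟩ : ∃ k, n = m + 1 + k := ⟨n - m - 1, by omega⟩
    rw [hprob, show m + 1 + k - m - 1 = k by omega]
    have h1 := hind.measure_inter_preimage_eq_mul _ _ ((hzero (m + d)).inter (hzero (m + d + (k + 1))))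
      ((hcross m).inter (hcross (m + 1 + k)))
    have h2 := measure_sum_range_eq_zero_inter hξm hξ hξlaw (m + d) (k + 1)
    have h3 := measure_crossing_inter_le hκ₂ hηm hη hηlaw m k
    calc _ = _ := by
          refine Eq.trans (congrArg P ?_) h1
          ext ω
          simp only [Set.mem_inter_iff, Set.mem_ofPred_eq, Set.mem_preimage,
            show m + 1 + k + d = m + d + (k + 1) by ring]
          tauto
      _ ≤ (convPow κ₁ (m + d) {0} * convPow κ₁ (k + 1) {0}) *
          (crossProb κ₂ m * (72 * crossProb κ₂ k)) := mul_le_mul' h2.le h3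
      _ = _ := by ring
  · intro N
    simp_rw [hprob]
    rw [← Finset.mul_sum, mul_assoc]
    gcongr
    interval_cases d
    · rw [Finset.sum_range_succ']
      refine (Finset.sum_le_sum fun n _ => hcmp n).trans ?_
      simp only [← Finset.mul_sum, mul_add, add_zero, le_self_add]
    · rw [Finset.sum_range_succ]
      exact (le_self_add).trans (le_mul_of_one_le_left (by simp) (by norm_num))

/-! ### A zero-one law for exchangeable events -/

/-- The Hewitt–Savage zero-one law for a product measure: an event has probability zero or one if,
for each `N`, it is invariant under a permutation of the coordinates which preserves the measure
and sends the first `N` coordinates to later ones. -/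
theorem measure_eq_zero_or_one_of_exchangeable {E : Type*} [MeasurableSpace E]
    (κ : ℕ → Measure E) [∀ i, IsProbabilityMeasure (κ i)] {A : Set (ℕ → E)}
    (hA : MeasurableSet A)
    (hinv : ∀ N : ℕ, ∃ e : Equiv.Perm ℕ, (∀ i, κ (e i) = κ i) ∧ (∀ i < N, N ≤ e i) ∧
      (fun (ω : ℕ → E) i => ω (e i)) ⁻¹' A = A) :
    Measure.infinitePi κ A = 0 ∨ Measure.infinitePi κ A = 1 := by
  set Q := Measure.infinitePi κ with hQ
  have key (ε : ℝ) (hε : 0 < ε) : |Q.real A - Q.real A * Q.real A| ≤ 4 * ε := by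
    -- `A` is approximated by an event `B` depending on finitely many coordinates, which is
    -- independent of its image under a suitable permutation.
    obtain ⟨B, hB, hBA⟩ := exists_measure_symmDiff_lt_of_generateFrom_isSetRing (μ := Q)
      isSetRing_measurableCylinders ⟨{Set.univ}, Set.countable_singleton _,
        Set.singleton_subset_iff.2 (univ_mem_measurableCylinders _), by simp⟩
      generateFrom_measurableCylinders.symm hA (ENNReal.ofReal_pos.2 hε)
    obtain ⟨s, S, hS, rfl⟩ := (mem_measurableCylinders _).1 hB
    set B : Set (ℕ → E) := cylinder (α := fun _ => E) s S with hBdef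
    have hBm : MeasurableSet B := MeasurableSet.of_mem_measurableCylinders hB
    obtain ⟨e, heκ, heN, heA⟩ := hinv (s.sup id + 1)
    set T : (ℕ → E) → ℕ → E := fun ω i => ω (e i) with hT
    have hTm : Measurable T := by fun_prop
    have hTQ : Q.map T = Q := by
      rw [hQ, hT, Measure.map_infinitePi_infinitePi_of_inj e.injective]
      simp only [heκ]
    have hTinv (C : Set (ℕ → E)) (hC : MeasurableSet C) : Q (T ⁻¹' C) = Q C := by
      rw [← Measure.map_apply hTm hC, hTQ]
    have hind : Q (B ∩ T ⁻¹' B) = Q B * Q B := by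
      have h1 : iIndepFun (fun (i : ℕ) (ω : ℕ → E) => ω i) Q :=
        iIndepFun_infinitePi (X := fun _ x => x) (by fun_prop)
      have h2 := h1.indepFun_finset s (s.map e.toEmbedding) (Finset.disjoint_left.2
        fun i hi hj => by
          obtain ⟨k, hk, rfl⟩ := Finset.mem_map.1 hj
          have h3 := heN k (Nat.lt_succ_of_le (Finset.le_sup (f := id) hk))
          have h4 := Finset.le_sup (f := id) hi
          simp only [id_eq, Equiv.coe_toEmbedding] at h3 h4
          omega) (by fun_prop)
      have h5 := h2.comp (φ := id)
        (ψ := fun x (i : s) => x ⟨e i, Finset.mem_map_of_mem _ i.2⟩) measurable_id (by fun_prop)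
      have h6 := h5.measure_inter_preimage_eq_mul S S hS hS
      have h7 : Q (T ⁻¹' B) = Q B := hTinv B hBm
      calc _ = _ := h6
        _ = Q B * Q (T ⁻¹' B) := rfl
        _ = _ := by rw [h7]
    have hBA' : Q.real (symmDiff A B) ≤ ε := by
      rw [symmDiff_comm, measureReal_def]
      exact ENNReal.toReal_le_of_le_ofReal hε.le hBA.le
    have hBA'' : Q.real (symmDiff A (T ⁻¹' B)) ≤ ε := by
      refine le_trans (le_of_eq ?_) hBA'
      rw [measureReal_def, measureReal_def, ← hTinv _ (hA.symmDiff hBm)]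
      congr 2
      conv_lhs => rw [← heA]
      rfl
    have h1 := (abs_measureReal_sub_le_measureReal_symmDiff (μ := Q) hA.nullMeasurableSet
      hBm.nullMeasurableSet).trans hBA'
    have h2 : |Q.real A - Q.real B * Q.real B| ≤ 2 * ε := by
      have : Q.real (B ∩ T ⁻¹' B) = Q.real B * Q.real B := by
        simp only [measureReal_def, hind, ENNReal.toReal_mul]
      rw [← this]
      refine (abs_measureReal_sub_le_measureReal_symmDiff hA.nullMeasurableSet
        (hBm.inter (hTm hBm)).nullMeasurableSet).trans ?_
      refine (measureReal_mono (s₂ := symmDiff A B ∪ symmDiff A (T ⁻¹' B)) ?_).trans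
        ((measureReal_union_le _ _).trans (by linarith))
      intro ω hω
      simp only [Set.mem_symmDiff, Set.mem_inter_iff, Set.mem_union] at hω ⊢
      tauto
    have hA1 : Q.real A ≤ 1 := measureReal_le_one
    have hB1 : Q.real B ≤ 1 := measureReal_le_one
    have hA0 : 0 ≤ Q.real A := measureReal_nonneg
    have hB0 : 0 ≤ Q.real B := measureReal_nonneg
    rw [abs_le] at *
    constructor <;> nlinarith
  have hsq : Q.real A - Q.real A * Q.real A = 0 := by
    rw [← abs_nonpos_iff]
    refine le_of_forall_pos_le_add fun ε hε => ?_
    have := key (ε / 4) (by positivity)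
    linarith
  have : Q.real A * (1 - Q.real A) = 0 := by linarith
  rcases mul_eq_zero.1 this with h | h
  · left
    rwa [measureReal_eq_zero_iff] at h
  · right
    rw [← ofReal_measureReal (μ := Q) (s := A), show Q.real A = 1 by linarith, ENNReal.ofReal_one]

/-! ### The words written during a half-cycle -/

/-- The expectation of a nonnegative function under a discrete distribution. -/
noncomputable def mean {α : Type*} (p : PMF α) (φ : α → ℝ≥0∞) : ℝ≥0∞ := ∑' a, p a * φ a

section Mean

variable {α β : Type*}

@[simp]
theorem mean_pure (a : α) (φ : α → ℝ≥0∞) : mean (PMF.pure a) φ = φ a := by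
  rw [mean, tsum_eq_single a fun b hb => by simp [hb]]
  simp

@[simp]
theorem mean_bind (p : PMF α) (f : α → PMF β) (φ : β → ℝ≥0∞) :
    mean (p.bind f) φ = mean p fun a => mean (f a) φ := by
  simp only [mean, PMF.bind_apply, ← ENNReal.tsum_mul_right, ← ENNReal.tsum_mul_left]
  rw [ENNReal.tsum_comm]
  simp only [mul_assoc]

@[simp]
theorem mean_map (p : PMF α) (f : α → β) (φ : β → ℝ≥0∞) :
    mean (p.map f) φ = mean p fun a => φ (f a) := by
  rw [PMF.map, mean_bind]
  simp

theorem mean_mono {p : PMF α} {φ ψ : α → ℝ≥0∞} (h : ∀ a, φ a ≤ ψ a) : mean p φ ≤ mean p ψ :=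
  ENNReal.tsum_le_tsum fun a => by gcongr; exact h a

theorem mean_add (p : PMF α) (φ ψ : α → ℝ≥0∞) :
    mean p (fun a => φ a + ψ a) = mean p φ + mean p ψ := by
  simp only [mean, mul_add, ENNReal.tsum_add]

theorem mean_const_mul (p : PMF α) (c : ℝ≥0∞) (φ : α → ℝ≥0∞) :
    mean p (fun a => c * φ a) = c * mean p φ := by
  simp only [mean, ← ENNReal.tsum_mul_left, mul_left_comm]

theorem mean_const (p : PMF α) (c : ℝ≥0∞) : mean p (fun _ => c) = c := by
  simp only [mean, ENNReal.tsum_mul_right, p.tsum_coe, one_mul]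

theorem mean_comm (p : PMF α) (q : PMF β) (φ : α → β → ℝ≥0∞) :
    (mean p fun a => mean q fun b => φ a b) = mean q fun b => mean p fun a => φ a b := by
  simp only [mean, ← ENNReal.tsum_mul_left]
  rw [ENNReal.tsum_comm]
  simp only [mul_left_comm]

theorem mean_sum {ι : Type*} (s : Finset ι) (p : PMF α) (φ : ι → α → ℝ≥0∞) :
    mean p (fun a => ∑ i ∈ s, φ i a) = ∑ i ∈ s, mean p (φ i) := by
  simp only [mean, Finset.mul_sum]
  exact Summable.tsum_finsetSum fun i _ => ENNReal.summable

theorem mean_uniform_bool (φ : Bool → ℝ≥0∞) :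
    mean (PMF.uniformOfFintype Bool) φ = 2⁻¹ * φ true + 2⁻¹ * φ false := by
  simp [mean, tsum_fintype]

theorem lintegral_toMeasure_eq_mean [MeasurableSpace α] [DiscreteMeasurableSpace α] [Countable α]
    (p : PMF α) (φ : α → ℝ≥0∞) : ∫⁻ a, φ a ∂p.toMeasure = mean p φ := by
  rw [lintegral_countable']
  exact tsum_congr fun a => by rw [p.toMeasure_apply_singleton a .of_discrete, mul_comm]

theorem toMeasure_apply_eq_mean [MeasurableSpace α] [DiscreteMeasurableSpace α] [Countable α]
    (p : PMF α) (s : Set α) : p.toMeasure s = mean p (s.indicator 1) := by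
  rw [← lintegral_toMeasure_eq_mean, lintegral_indicator_one .of_discrete]

end Mean

instance : Fintype Letter where
  elems := {.e, .n, .w, .s}
  complete l := by cases l <;> simp

instance : DiscreteMeasurableSpace Letter := ⟨fun _ => trivial⟩

instance : MeasurableSpace (List Letter) := ⊤

instance : DiscreteMeasurableSpace (List Letter) := ⟨fun _ => trivial⟩

/-- The opposite direction. -/
def Letter.opp : Letter → Letter
  | .e => .w
  | .n => .s
  | .w => .e
  | .s => .n

/-- The displacement along a finite word. -/
def disp (c : List Letter) : ℤ × ℤ := (c.map Letter.dir).sum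

@[simp]
theorem disp_nil : disp [] = 0 := rfl

@[simp]
theorem disp_append (c c' : List Letter) : disp (c ++ c') = disp c + disp c' := by
  simp [disp]

@[simp]
theorem disp_replicate (t : ℕ) (l : Letter) : disp (List.replicate t l) = (t : ℤ) • l.dir := by
  simp [disp]

theorem Letter.dir_opp (l : Letter) : l.opp.dir = -l.dir := by cases l <;> rfl

section HalfCycle

/-- The law of the word made of `g` successive runs, the first one in direction `l` and each of the others in
the direction opposite to the preceding one. -/
noncomputable def zigzag (ν : PMF ℕ+) : Letter → ℕ → PMF (List Letter)
  | _, 0 => PMF.pure []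
  | l, g + 1 => ν.bind fun t => (zigzag ν l.opp g).map (List.replicate t l ++ ·)

/-- The law of the number of U-turns before the walk leaves its axis. -/
noncomputable def reversals (p : unitInterval) : PMF ℕ :=
  (geometricMeasure (unitInterval.symm p)).toPMF

/-- The law of a half-cycle, that is, of the word written while the walk stays on one axis, starting
in direction `l`. -/
noncomputable def halfWord (ν : PMF ℕ+) (p : unitInterval) (l : Letter) : PMF (List Letter) :=
  (reversals p).bind fun j => zigzag ν l (j + 1)

/-- The law of the alternating sum of `g` independent variables with law `ν`. -/
noncomputable def altSum (ν : PMF ℕ+) : ℕ → PMF ℤ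
  | 0 => PMF.pure 0
  | g + 1 => ν.bind fun t => (altSum ν g).map fun z => (t : ℤ) - z

variable {ν : PMF ℕ+} {p : unitInterval}

theorem reversals_apply (hp : p < 1) (j : ℕ) :
    reversals p j = ENNReal.ofReal ((p : ℝ) ^ j * (1 - p)) := by
  have h : unitInterval.symm p ≠ 0 := by
    rw [ne_eq, unitInterval.symm_eq_zero]
    exact hp.ne
  rw [reversals, Measure.toPMF_apply, geometricMeasure_singleton h]
  simp

theorem reversals_zero (hp : p < 1) : reversals p 0 = ENNReal.ofReal (1 - p) := by
  simp [reversals_apply hp]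

theorem reversals_add (hp : p < 1) (k j : ℕ) :
    reversals p (j + k) = ENNReal.ofReal p ^ k * reversals p j := by
  rw [reversals_apply hp, reversals_apply hp, ← ENNReal.ofReal_pow p.2.1,
    ← ENNReal.ofReal_mul (pow_nonneg p.2.1 _)]
  ring_nf

theorem mean_reversals (hp : p < 1) (φ : ℕ → ℝ≥0∞) :
    mean (reversals p) φ = ENNReal.ofReal (1 - p) * φ 0 +
      ENNReal.ofReal p * mean (reversals p) fun j => φ (j + 1) := by
  rw [mean, tsum_eq_zero_add' ENNReal.summable, reversals_zero hp, mean, ← ENNReal.tsum_mul_left]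
  simp only [reversals_add hp 1, pow_one, mul_assoc]

/-- Once its first run is completed, a half-cycle stops or starts again in the opposite
direction. -/
theorem mean_halfWord (hp : p < 1) (l : Letter) (φ : List Letter → ℝ≥0∞) :
    mean (halfWord ν p l) φ = mean ν fun t =>
      ENNReal.ofReal (1 - p) * φ (List.replicate t l) +
        ENNReal.ofReal p * mean (halfWord ν p l.opp) fun c => φ (List.replicate t l ++ c) := by
  have hzig (g : ℕ) : mean (zigzag ν l (g + 1)) φ =
      mean ν fun t => mean (zigzag ν l.opp g) fun c => φ (List.replicate t l ++ c) := by
    simp only [zigzag, mean_bind, mean_map]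
  rw [halfWord, mean_bind, mean_reversals hp, mean_add, mean_const_mul, mean_const_mul]
  simp only [hzig, halfWord, mean_bind]
  rw [mean_comm (reversals p) ν]
  simp [zigzag]

/-- The displacement during `g` successive runs is an alternating sum. -/
theorem mean_zigzag_disp (l : Letter) (g : ℕ) (φ : ℤ × ℤ → ℝ≥0∞) :
    mean (zigzag ν l g) (fun c => φ (disp c)) = mean (altSum ν g) fun z => φ (z • l.dir) := by
  induction g generalizing l φ with
  | zero => simp [zigzag, altSum]
  | succ g ih =>
    simp only [zigzag, altSum, mean_bind, mean_map, disp_append, disp_replicate]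
    congr 1
    ext t
    rw [ih l.opp fun x => φ (((t : ℕ) : ℤ) • l.dir + x)]
    simp [Letter.dir_opp, sub_eq_add_neg, add_mul]

theorem altSum_succ_eq_bind (g : ℕ) :
    altSum ν (g + 1) = (altSum ν g).bind fun z => ν.map fun t : ℕ+ => z + (-1) ^ g * (t : ℤ) := by
  induction g with
  | zero => simp [altSum, PMF.map]; rfl
  | succ g ih =>
    change (ν.bind fun t => (altSum ν (g + 1)).map fun z => (t : ℤ) - z) =
      (ν.bind fun t => (altSum ν g).map fun z => (t : ℤ) - z).bind _
    rw [ih]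
    simp only [PMF.map_bind, PMF.bind_bind, PMF.bind_map, PMF.map_comp]
    congr 1
    ext1 t
    congr 1
    ext1 z
    simp only [Function.comp_def]
    congr 1
    ext1 s
    ring

/-- The two encodings of the alternating sums agree: one adds the last term to a sum of independent
variables, the other one adds the first term. -/
theorem map_infinitePi_alternating (g : ℕ) :
    (Measure.infinitePi fun _ : ℕ => intLaw ν).map
      (fun τ => ∑ k ∈ Finset.range g, (-1) ^ k * τ k) = (altSum ν g).toMeasure := by
  have hprob : IsProbabilityMeasure (intLaw ν) := by rw [intLaw]; infer_instance
  induction g with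
  | zero => simp [altSum, Measure.map_const, PMF.toMeasure_pure]
  | succ g ih =>
    set Q := Measure.infinitePi fun _ : ℕ => intLaw ν
    have hind : iIndepFun (fun (i : ℕ) (ω : ℕ → ℤ) => ω i) Q :=
      iIndepFun_infinitePi (X := fun _ x => x) (by fun_prop)
    have h1 := indepFun_sum_range (P := Q) (ξ := fun k τ => (-1) ^ k * τ k) (by fun_prop)
      (hind.comp (fun k x => (-1) ^ k * x) fun _ => .of_discrete) g
    have h2 := h1.map_add_eq_map_conv_map (by fun_prop) (by fun_prop)
    have h3 : Q.map (fun τ => (-1) ^ g * τ g) =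
        (ν.map fun t : ℕ+ => (-1) ^ g * (t : ℤ)).toMeasure := by
      have : Q.map (fun τ => τ g) = intLaw ν := Measure.infinitePi_map_eval _ g
      rw [← Function.comp_def (fun x : ℤ => (-1) ^ g * x) (fun τ : ℕ → ℤ => τ g),
        ← Measure.map_map .of_discrete (by fun_prop), this, intLaw,
        PMF.toMeasure_map _ _ .of_discrete, PMF.map_comp]
      rfl
    have h4 : (fun τ : ℕ → ℤ => ∑ k ∈ Finset.range (g + 1), (-1) ^ k * τ k) =
        (fun τ => ∑ k ∈ Finset.range g, (-1) ^ k * τ k) + fun τ => (-1) ^ g * τ g := by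
      ext τ; simp [Finset.sum_range_succ]
    rw [h4, h2, ih, h3, altSum_succ_eq_bind]
    refine Measure.ext fun A _ => ?_
    rw [conv_apply_int, Measure.prod_apply .of_discrete, lintegral_toMeasure_eq_mean,
      toMeasure_apply_eq_mean, mean_bind]
    congr 1
    ext z
    rw [toMeasure_apply_eq_mean, mean_map, mean_map]
    rfl

/-- The displacement, along the axis, during a half-cycle whose first direction is chosen by a fair
coin, has law `jumpLaw ν p`. -/
theorem jumpLaw_apply (A : Set ℤ) :
    jumpLaw ν p A = 2⁻¹ * mean (reversals p) (fun j => mean (altSum ν (j + 1)) (A.indicator 1)) +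
      2⁻¹ * mean (reversals p)
        (fun j => mean (altSum ν (j + 1)) fun z => A.indicator 1 (-z)) := by
  have hprob : IsProbabilityMeasure (intLaw ν) := by rw [intLaw]; infer_instance
  have hgeo : IsProbabilityMeasure (geometricLaw p) := by
    rw [geometricLaw]; exact Measure.isProbabilityMeasure_map .of_discrete
  set Q := Measure.infinitePi fun _ : ℕ => intLaw ν with hQ
  have hA := measurable_signedAlternatingSum (MeasurableSet.of_discrete (s := A))
  have hval (ε : ℤ) : ((geometricLaw p).prod Q) (Prod.mk ε ⁻¹' (signedAlternatingSum ⁻¹' A)) =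
      mean (reversals p) fun j => mean (altSum ν (j + 1)) fun z => A.indicator 1 (ε * z) := by
    rw [Measure.prod_apply (measurable_prodMk_left hA), geometricLaw,
      lintegral_map .of_discrete .of_discrete, ← (geometricMeasure _).toPMF_toMeasure,
      lintegral_toMeasure_eq_mean]
    congr 1
    ext j
    have : Prod.mk (j + 1) ⁻¹' (Prod.mk ε ⁻¹' (signedAlternatingSum ⁻¹' A)) =
        (fun τ : ℕ → ℤ => ∑ k ∈ Finset.range (j + 1), (-1) ^ k * τ k) ⁻¹' ((ε * ·) ⁻¹' A) := rfl
    rw [this, ← Measure.map_apply (by fun_prop) .of_discrete, map_infinitePi_alternating,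
      toMeasure_apply_eq_mean]
    rfl
  rw [jumpLaw, Measure.map_apply measurable_signedAlternatingSum .of_discrete,
    Measure.prod_apply hA, rademacher, lintegral_add_measure, lintegral_smul_measure,
    lintegral_smul_measure, lintegral_dirac, lintegral_dirac, hval, hval]
  simp

/-- `x` lies beyond `z`, as seen from the origin. -/
def Beyond (z x : ℤ) : Prop := (0 ≤ z ∧ z ≤ x) ∨ (z ≤ 0 ∧ x ≤ z)

/-- The path of the word `c` meets the point with abscissa `z` on the axis directed by `l`. -/
def Visits (l : Letter) (z : ℤ) (c : List Letter) : Prop :=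
  ∃ k ≤ c.length, disp (c.take k) = z • l.dir

theorem Letter.smul_dir_injective (l : Letter) : Function.Injective fun z : ℤ => z • l.dir := by
  intro a b h
  cases l <;> simpa [Letter.dir] using h

/-- After a run of length `t` in direction `l`, the point `z` is at distance `t - z` in the opposite
direction. -/
theorem visits_replicate_append (l : Letter) (z : ℤ) (t : ℕ) (c : List Letter) :
    Visits l z (List.replicate t l ++ c) ↔ (0 ≤ z ∧ z ≤ t) ∨ Visits l.opp (t - z) c := by
  have hopp : (((t : ℤ) - z) • l.opp.dir) = z • l.dir - (t : ℤ) • l.dir := by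
    rw [Letter.dir_opp, smul_neg, sub_smul, neg_sub]
  constructor
  · rintro ⟨k, hk, h⟩
    rcases le_total k t with hkt | hkt
    · left
      rw [List.take_append_of_le_length (by simpa using hkt), List.take_replicate,
        disp_replicate] at h
      have := l.smul_dir_injective h
      omega
    · right
      obtain ⟨j, rfl⟩ := exists_add_of_le hkt
      refine ⟨j, by simpa using hk, ?_⟩
      rw [List.take_append, List.take_of_length_le (by simp), disp_append, disp_replicate] at h
      rw [hopp, ← h]
      simp
  · rintro (⟨h0, h1⟩ | ⟨k, hk, h⟩)
    · refine ⟨z.toNat, by simp; omega, ?_⟩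
      rw [List.take_append_of_le_length (by simp; omega), List.take_replicate, disp_replicate]
      congr 1
      omega
    · refine ⟨t + k, by simpa using hk, ?_⟩
      rw [List.take_append, List.take_of_length_le (by simp), disp_append, disp_replicate]
      simp only [List.length_replicate, Nat.add_sub_cancel_left]
      rw [h, hopp]
      abel

open Classical in
/-- A path that meets `z` ends some run beyond `z`, namely the run during which `z` is met for the
first time. -/
theorem mean_zigzag_visits_le (l : Letter) (g : ℕ) (z : ℤ) (h : z ≠ 0 ∨ g ≠ 0) :
    mean (zigzag ν l g) (fun c => if Visits l z c then 1 else 0) ≤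
      ∑ k ∈ Finset.range g, mean (altSum ν (k + 1)) fun x => if Beyond z x then 1 else 0 := by
  induction g generalizing l z with
  | zero =>
    have h0 : z ≠ 0 := by simpa using h
    have hv : ¬ Visits l z [] := by
      rintro ⟨k, hk, hd⟩
      simp only [List.take_nil, disp_nil] at hd
      exact h0 (l.smul_dir_injective (hd.symm.trans (zero_smul ℤ _).symm))
    simp [zigzag, hv]
  | succ g ih =>
    rw [Finset.sum_range_succ']
    simp only [zigzag, mean_bind, mean_map, visits_replicate_append]
    have hfirst : mean (altSum ν (0 + 1)) (fun x => if Beyond z x then 1 else 0) =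
        mean ν fun t : ℕ+ => if Beyond z (t : ℤ) then 1 else 0 := by
      simp [altSum]
    have hnext (k : ℕ) : mean (altSum ν (k + 1 + 1)) (fun x => if Beyond z x then 1 else 0) =
        mean ν fun t : ℕ+ => mean (altSum ν (k + 1)) fun x =>
          if Beyond z ((t : ℤ) - x) then 1 else 0 := by
      rw [show altSum ν (k + 1 + 1) =
        ν.bind fun t => (altSum ν (k + 1)).map fun z => (t : ℤ) - z from rfl]
      simp only [mean_bind, mean_map]
    rw [hfirst]
    simp only [hnext]
    rw [← mean_sum, ← mean_add]
    refine mean_mono fun t => ?_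
    have ht : (0 : ℤ) < ((t : ℕ) : ℤ) := by exact_mod_cast t.pos
    by_cases hz : Beyond z (t : ℤ)
    · refine le_trans ?_ le_add_self
      rw [if_pos hz]
      refine (mean_mono (ψ := fun _ => 1) fun c => ?_).trans (mean_const _ _).le
      split_ifs
      · exact le_rfl
      · exact zero_le_one
    · have hz' : ¬ (0 ≤ z ∧ z ≤ ((t : ℕ) : ℤ)) := fun h' => hz (Or.inl h')
      simp only [hz', false_or, hz, if_false, add_zero]
      refine (ih l.opp _ (Or.inl (by omega))).trans (Finset.sum_le_sum fun k _ => ?_)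
      refine mean_mono fun x => ?_
      by_cases hx : Beyond ((t : ℤ) - z) x
      · rw [if_pos (by unfold Beyond at hx ⊢; omega : Beyond z ((t : ℤ) - x))]
        split_ifs
        simp
      · rw [if_neg hx]
        simp

/-- A geometric variable reaches `k` with probability `(1 - p)⁻¹` times that of being equal to `k`. -/
theorem mean_reversals_sum_le (hp : p < 1) (a : ℕ → ℝ≥0∞) :
    mean (reversals p) (fun j => ∑ k ∈ Finset.range (j + 1), a k) ≤
      (ENNReal.ofReal (1 - p))⁻¹ * mean (reversals p) a := by
  have hp' : ENNReal.ofReal (1 - p) ≠ 0 := by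
    rw [ne_eq, ENNReal.ofReal_eq_zero, not_le, sub_pos]
    exact_mod_cast hp
  have hsum (j : ℕ) : ∑ k ∈ Finset.range (j + 1), a k = ∑' k, if k ≤ j then a k else 0 := by
    rw [tsum_eq_sum (s := Finset.range (j + 1)) fun k hk => if_neg (by simpa using hk)]
    exact Finset.sum_congr rfl fun k hk => (if_pos (by simpa [Nat.lt_succ_iff] using hk)).symm
  have htail (k : ℕ) : ∑' j, reversals p j * (if k ≤ j then a k else 0) =
      ENNReal.ofReal p ^ k * a k := by
    rw [← Summable.sum_add_tsum_nat_add' (k := k) ENNReal.summable, Finset.sum_eq_zero, zero_add]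
    · simp only [le_add_iff_nonneg_left, zero_le, if_true, reversals_add hp k]
      rw [ENNReal.tsum_mul_right, ENNReal.tsum_mul_left, PMF.tsum_coe, mul_one]
    · intro j hj
      rw [if_neg (by simpa using hj), mul_zero]
  simp only [mean, hsum, ← ENNReal.tsum_mul_left]
  rw [ENNReal.tsum_comm]
  refine ENNReal.tsum_le_tsum fun k => ?_
  rw [htail, show reversals p k = ENNReal.ofReal p ^ k * ENNReal.ofReal (1 - p) by
    simpa [reversals_zero hp] using reversals_add hp k 0]
  calc _ = ((ENNReal.ofReal (1 - p))⁻¹ * ENNReal.ofReal (1 - p)) * (ENNReal.ofReal p ^ k * a k) := by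
        rw [ENNReal.inv_mul_cancel hp' ENNReal.ofReal_ne_top, one_mul]
    _ ≤ _ := le_of_eq (by ring)

open Classical in
/-- A half-cycle meets `z` with a probability comparable to that of ending beyond `z`, since each
run is the last one of its half-cycle with probability `1 - p`. -/
theorem mean_halfWord_visits_le (hp : p < 1) (l : Letter) (z : ℤ) :
    mean (halfWord ν p l) (fun c => if Visits l z c then 1 else 0) ≤
      (ENNReal.ofReal (1 - p))⁻¹ * mean (reversals p) fun j =>
        mean (altSum ν (j + 1)) fun x => if Beyond z x then 1 else 0 := by
  rw [halfWord, mean_bind]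
  exact (mean_mono fun j => mean_zigzag_visits_le l (j + 1) z (Or.inr (by simp))).trans
    (mean_reversals_sum_le hp _)

end HalfCycle

/-! ### Concatenation of words and visits to the origin -/

/-- The concatenation of the first `n` words of a sequence. -/
def concat (ω : ℕ → List Letter) (n : ℕ) : List Letter := (List.range n).flatMap ω

/-- The infinite concatenation of a sequence of nonempty words. As each of the words has at least
one letter, the first `k + 1` words determine the letter number `k`. -/
def path (ω : ℕ → List Letter) (k : ℕ) : Letter := (concat ω (k + 1)).getD k .e

/-- The word made of the first `n` letters of an infinite word. -/
def initial (x : ℕ → Letter) (n : ℕ) : List Letter := (List.range n).map x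

/-- The walk visits the origin while writing the word `ω i`, its starting point included. -/
def SegmentHits (i : ℕ) (ω : ℕ → List Letter) : Prop :=
  ∃ k ≤ (ω i).length, disp (concat ω i) + disp ((ω i).take k) = 0

theorem concat_succ (ω : ℕ → List Letter) (n : ℕ) : concat ω (n + 1) = concat ω n ++ ω n := by
  simp [concat, List.range_succ]

theorem concat_prefix (ω : ℕ → List Letter) {m n : ℕ} (h : m ≤ n) : concat ω m <+: concat ω n := by
  induction n, h using Nat.le_induction with
  | base => exact List.prefix_rfl
  | succ n _ ih => exact ih.trans (by rw [concat_succ]; exact List.prefix_append _ _)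

theorem disp_concat (ω : ℕ → List Letter) (n : ℕ) :
    disp (concat ω n) = ∑ i ∈ Finset.range n, disp (ω i) := by
  induction n with
  | zero => rfl
  | succ n ih => rw [concat_succ, disp_append, ih, Finset.sum_range_succ]

theorem le_length_concat {ω : ℕ → List Letter} (hω : ∀ i, ω i ≠ []) (n : ℕ) :
    n ≤ (concat ω n).length := by
  induction n with
  | zero => simp
  | succ n ih =>
    rw [concat_succ, List.length_append]
    have := List.length_pos_iff.2 (hω n)
    omega

theorem path_eq_getElem {ω : ℕ → List Letter} (hω : ∀ i, ω i ≠ []) {k n : ℕ}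
    (hk : k < (concat ω n).length) : path ω k = (concat ω n)[k] := by
  have hk' : k < (concat ω (k + 1)).length := le_length_concat hω (k + 1)
  rw [path, List.getD_eq_getElem _ _ hk']
  rcases le_total (k + 1) n with h | h
  · exact (concat_prefix ω h).getElem hk'
  · exact ((concat_prefix ω h).getElem hk).symm

theorem initial_path {ω : ℕ → List Letter} (hω : ∀ i, ω i ≠ []) {k n : ℕ}
    (hk : k ≤ (concat ω n).length) : initial (path ω) k = (concat ω n).take k := by
  refine List.ext_getElem (by simp [initial, hk]) fun j h1 h2 => ?_
  simp only [List.length_take, lt_min_iff] at h2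
  simp only [initial, List.getElem_map, List.getElem_range, List.getElem_take]
  exact path_eq_getElem hω h2.2

theorem disp_initial (x : ℕ → Letter) (n : ℕ) :
    disp (initial x n) = ∑ k ∈ Finset.range n, (x k).dir := by
  induction n with
  | zero => rfl
  | succ n ih =>
    rw [Finset.sum_range_succ, ← ih, initial, List.range_succ, List.map_append, disp_append]
    simp [disp, initial]

/-- The path visits the origin infinitely often if and only if it does so during infinitely many
of the words it is made of. -/
theorem frequently_sum_path_eq_zero_iff {ω : ℕ → List Letter} (hω : ∀ i, ω i ≠ []) :
    (∃ᶠ n in atTop, ∑ k ∈ Finset.range n, (path ω k).dir = 0) ↔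
      ∃ᶠ i in atTop, SegmentHits i ω := by
  simp only [frequently_atTop]
  constructor
  · intro h I
    obtain ⟨n, hn, hn0⟩ := h (concat ω I).length
    have hex : ∃ j, n < (concat ω (j + 1)).length := ⟨n, le_length_concat hω (n + 1)⟩
    classical
    obtain ⟨j, hj, hmin⟩ : ∃ j, n < (concat ω (j + 1)).length ∧ (concat ω j).length ≤ n := by
      refine ⟨Nat.find hex, Nat.find_spec hex, ?_⟩
      rcases hfind : Nat.find hex with _ | m
      · simp [concat]
      · exact not_lt.1 (Nat.find_min hex (by omega))
    refine ⟨j, ?_, n - (concat ω j).length, ?_, ?_⟩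
    · by_contra! hlt
      have := (concat_prefix ω (show j + 1 ≤ I from hlt)).length_le
      omega
    · rw [concat_succ, List.length_append] at hj
      omega
    · rw [← disp_initial, initial_path hω hj.le, concat_succ, List.take_append,
        List.take_of_length_le hmin, disp_append] at hn0
      exact hn0
  · intro h N
    obtain ⟨i, hi, k, hk, h0⟩ := h N
    refine ⟨(concat ω i).length + k, ?_, ?_⟩
    · have := le_length_concat hω i
      omega
    · rw [← disp_initial, initial_path (n := i + 1) hω (by
        rw [concat_succ, List.length_append]; omega), concat_succ, List.take_append,
        List.take_of_length_le (by omega), disp_append]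
      simpa using h0

/-- The horizontal directions if `i` is even, the vertical ones if `i` is odd; the direction of
`true` is the positive one. -/
def axisLetter (i : ℕ) (b : Bool) : Letter :=
  if Even i then (if b then .e else .w) else (if b then .n else .s)

/-- The horizontal coordinate if `i` is even, the vertical one if `i` is odd. -/
def along (i : ℕ) (x : ℤ × ℤ) : ℤ := if Even i then x.1 else x.2

/-- A nonempty word whose letters are horizontal if `i` is even, and vertical if `i` is odd. -/
def IsAxisWord (i : ℕ) (c : List Letter) : Prop :=
  c ≠ [] ∧ ∀ x ∈ c, (x.IsHorizontal ↔ Even i)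

theorem along_add (i : ℕ) (x y : ℤ × ℤ) : along i (x + y) = along i x + along i y := by
  unfold along; split_ifs <;> rfl

theorem along_zero (i : ℕ) : along i 0 = 0 := by
  unfold along; split_ifs <;> rfl

theorem along_axisLetter (i : ℕ) (z : ℤ) : along i (z • (axisLetter i true).dir) = z := by
  by_cases hi : Even i <;> simp [along, axisLetter, hi, Letter.dir]

theorem ext_along {i : ℕ} {x y : ℤ × ℤ} (h : along i x = along i y)
    (h' : along (i + 1) x = along (i + 1) y) : x = y := by
  by_cases hi : Even i
  · have hi' : ¬ Even (i + 1) := by simpa [Nat.even_add_one] using hi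
    simp only [along, hi, hi', if_true, if_false] at h h'
    exact Prod.ext h h'
  · have hi' : Even (i + 1) := by simpa [Nat.even_add_one] using hi
    simp only [along, hi, hi', if_true, if_false] at h h'
    exact Prod.ext h' h

theorem along_congr {i j : ℕ} (h : Even i ↔ Even j) (x : ℤ × ℤ) : along i x = along j x := by
  simp [along, h]

theorem along_succ_disp_eq_zero {i : ℕ} {c : List Letter}
    (hc : ∀ x ∈ c, (x.IsHorizontal ↔ Even i)) : along (i + 1) (disp c) = 0 := by
  induction c with
  | nil => exact along_zero _
  | cons l c ih =>
    have hl := hc l (by simp)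
    rw [show disp (l :: c) = l.dir + disp c by simp [disp], along_add,
      ih fun x hx => hc x (by simp [hx]), add_zero]
    clear ih hc
    by_cases hi : Even i <;> cases l <;>
      simp only [Letter.IsHorizontal, hi, iff_true, iff_false] at hl <;>
      simp [along, Letter.dir, Nat.even_add_one, -Nat.not_even_iff_odd, hi] <;> tauto

theorem disp_eq_smul {i : ℕ} {c : List Letter} (hc : ∀ x ∈ c, (x.IsHorizontal ↔ Even i)) :
    disp c = along i (disp c) • (axisLetter i true).dir := by
  refine ext_along (i := i) (along_axisLetter _ _).symm ?_
  rw [along_succ_disp_eq_zero hc]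
  by_cases hi : Even i <;> simp [along, axisLetter, hi, Letter.dir, Nat.even_add_one]

/-- A path along an axis does not jump over points. -/
theorem visits_of_between {i : ℕ} {c : List Letter} (hc : ∀ x ∈ c, (x.IsHorizontal ↔ Even i))
    {z : ℤ} (h0 : 0 ≤ z) (h1 : z ≤ along i (disp c)) : Visits (axisLetter i true) z c := by
  induction c generalizing z with
  | nil =>
    rw [disp_nil, along_zero] at h1
    exact ⟨0, le_rfl, by simp [show z = 0 by omega]⟩
  | cons l c ih =>
    rcases h0.eq_or_lt with rfl | h0
    · exact ⟨0, by simp, by simp⟩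
    · have hl : l.dir = along i l.dir • (axisLetter i true).dir := by
        have := disp_eq_smul (i := i) (c := [l]) fun x hx => by
          rw [List.mem_singleton.1 hx]; exact hc l (by simp)
        simpa [disp] using this
      have hle : along i l.dir ≤ 1 := by
        unfold along; split_ifs <;> cases l <;> simp [Letter.dir]
      rw [show disp (l :: c) = l.dir + disp c by simp [disp], along_add] at h1
      obtain ⟨k, hk, h⟩ := ih (fun x hx => hc x (by simp [hx])) (z := z - along i l.dir)
        (by omega) (by omega)
      refine ⟨k + 1, by simpa using hk, ?_⟩
      rw [List.take_succ_cons, show disp (l :: c.take k) = l.dir + disp (c.take k) by simp [disp],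
        h, sub_smul, ← hl]
      abel

/-- The displacement of the word number `2 * k + d` along its axis. -/
def jump (d k : ℕ) (ω : ℕ → List Letter) : ℤ := along d (disp (ω (2 * k + d)))

/-- The walk visits the origin during the word number `2 * n + d` if and only if the other
coordinate is zero and the word meets the origin of its axis. -/
theorem segmentHits_iff {ω : ℕ → List Letter} (hω : ∀ i, IsAxisWord i (ω i)) {d : ℕ} (hd : d ≤ 1)
    (n : ℕ) : SegmentHits (2 * n + d) ω ↔
      ∑ k ∈ Finset.range (n + d), jump (1 - d) k ω = 0 ∧
        Visits (axisLetter d true) (-∑ k ∈ Finset.range n, jump d k ω) (ω (2 * n + d)) := by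
  have hpar (k : ℕ) : Even (2 * k + d) ↔ Even d := by simp [Nat.even_add]
  have hzero (j k : ℕ) (h : ¬ (Even j ↔ Even k)) : along j (disp (ω k)) = 0 := by
    rw [along_congr (j := k + 1) (by rw [Nat.even_add_one]; tauto)]
    exact along_succ_disp_eq_zero (hω k).2
  have hpos (j m : ℕ) : along j (disp (concat ω (2 * m))) =
      ∑ k ∈ Finset.range m, (along j (disp (ω (2 * k))) + along j (disp (ω (2 * k + 1)))) := by
    induction m with
    | zero => exact along_zero _
    | succ m ih =>
      rw [show 2 * (m + 1) = 2 * m + 1 + 1 by ring, concat_succ, concat_succ, disp_append,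
        disp_append, along_add, along_add, ih, Finset.sum_range_succ, add_assoc]
  have hown : along d (disp (concat ω (2 * n + d))) = ∑ k ∈ Finset.range n, jump d k ω := by
    interval_cases d
    · rw [add_zero, hpos]
      refine Finset.sum_congr rfl fun k _ => ?_
      rw [hzero 0 (2 * k + 1) (by simp), add_zero, jump, add_zero]
    · rw [concat_succ, disp_append, along_add, hpos, hzero 1 (2 * n) (by simp), add_zero]
      refine Finset.sum_congr rfl fun k _ => ?_
      rw [hzero 1 (2 * k) (by simp), zero_add, jump]
  have hother : along (d + 1) (disp (concat ω (2 * n + d))) =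
      ∑ k ∈ Finset.range (n + d), jump (1 - d) k ω := by
    interval_cases d
    · rw [add_zero, hpos]
      refine Finset.sum_congr rfl fun k _ => ?_
      rw [hzero (0 + 1) (2 * k) (by simp), zero_add, jump]
    · rw [along_congr (j := 0) (by decide), concat_succ, disp_append, along_add, hpos,
        Finset.sum_range_succ]
      congr 1
      refine Finset.sum_congr rfl fun k _ => ?_
      rw [hzero 0 (2 * k + 1) (by simp), add_zero, jump]
      rfl
  have hword (x : Letter) (hx : x ∈ ω (2 * n + d)) : x.IsHorizontal ↔ Even d := by
    rw [(hω _).2 x hx, hpar]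
  rw [← hown, ← hother]
  constructor
  · rintro ⟨k, hk, h⟩
    have htake : ∀ x ∈ (ω (2 * n + d)).take k, (x.IsHorizontal ↔ Even d) :=
      fun x hx => hword x (List.mem_of_mem_take hx)
    have h1 := congrArg (along d) h
    have h2 := congrArg (along (d + 1)) h
    rw [along_add, along_zero] at h1 h2
    rw [along_succ_disp_eq_zero htake, add_zero] at h2
    refine ⟨h2, k, hk, ?_⟩
    rw [disp_eq_smul htake]
    congr 1
    omega
  · rintro ⟨h2, k, hk, h⟩
    have htake : ∀ x ∈ (ω (2 * n + d)).take k, (x.IsHorizontal ↔ Even d) :=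
      fun x hx => hword x (List.mem_of_mem_take hx)
    refine ⟨k, hk, ext_along (i := d) ?_ ?_⟩
    · rw [along_add, along_zero, h, along_axisLetter]
      omega
    · rw [along_add, along_zero, along_succ_disp_eq_zero htake, h2, add_zero]

/-! ### Independent half-cycles -/

/-- `a` if `i` is even and `b` if `i` is odd: the analogue of `byAxis` for the half-cycles, which
are horizontal if their number is even. -/
def byParity {T : Type*} (a b : T) (i : ℕ) : T := if Even i then a else b

theorem byParity_two_mul_add {T : Type*} (a b : T) (k d : ℕ) :
    byParity a b (2 * k + d) = byParity a b d := by simp [byParity, Nat.even_add]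

theorem axisLetter_two_mul_add (k d : ℕ) (b : Bool) : axisLetter (2 * k + d) b = axisLetter d b := by
  simp [axisLetter, Nat.even_add]

theorem axisLetter_opp (i : ℕ) (b : Bool) : (axisLetter i b).opp = axisLetter i !b := by
  by_cases hi : Even i <;> cases b <;> simp [axisLetter, hi, Letter.opp]

theorem axisLetter_isHorizontal_iff (i : ℕ) (b : Bool) :
    (axisLetter i b).IsHorizontal ↔ Even i := by
  by_cases hi : Even i <;> cases b <;> simp [axisLetter, hi, Letter.IsHorizontal]

theorem Letter.opp_isHorizontal_iff (l : Letter) : l.opp.IsHorizontal ↔ l.IsHorizontal := by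
  cases l <;> simp [Letter.opp, Letter.IsHorizontal]

theorem map_neg_jumpLaw (ν : PMF ℕ+) (p : unitInterval) :
    (jumpLaw ν p).map Neg.neg = jumpLaw ν p := by
  refine Measure.ext fun A _ => ?_
  rw [Measure.map_apply .of_discrete .of_discrete, jumpLaw_apply, jumpLaw_apply, add_comm]
  have h (z : ℤ) : (Neg.neg ⁻¹' A).indicator (1 : ℤ → ℝ≥0∞) z = A.indicator 1 (-z) := rfl
  simp only [funext h, neg_neg]

instance isProbabilityMeasure_jumpLaw (ν : PMF ℕ+) (p : unitInterval) :
    IsProbabilityMeasure (jumpLaw ν p) where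
  measure_univ := by
    rw [jumpLaw_apply]
    simp only [Set.indicator_univ, Pi.one_def, mean_const]
    simp [ENNReal.inv_two_add_inv_two]

section Model

variable (νh νv : PMF ℕ+) (ph pv : unitInterval)

/-- The law of the half-cycle number `i`, whose first direction is chosen by a fair coin. -/
noncomputable def halfCycleLaw (i : ℕ) : PMF (List Letter) :=
  (PMF.uniformOfFintype Bool).bind fun b =>
    halfWord (byParity νh νv i) (byParity ph pv i) (axisLetter i b)

/-- The law of a sequence of independent half-cycles, alternately horizontal and vertical. -/
noncomputable def wordMeasure : Measure (ℕ → List Letter) :=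
  Measure.infinitePi fun i => (halfCycleLaw νh νv ph pv i).toMeasure

instance : IsProbabilityMeasure (wordMeasure νh νv ph pv) := by
  rw [wordMeasure]; infer_instance

theorem halfCycleLaw_two_mul_add (k d : ℕ) :
    halfCycleLaw νh νv ph pv (2 * k + d) = halfCycleLaw νh νv ph pv d := by
  simp only [halfCycleLaw, byParity_two_mul_add, axisLetter_two_mul_add]

theorem mean_halfCycleLaw (i : ℕ) (φ : List Letter → ℝ≥0∞) :
    mean (halfCycleLaw νh νv ph pv i) φ =
      2⁻¹ * mean (halfWord (byParity νh νv i) (byParity ph pv i) (axisLetter i true)) φ +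
      2⁻¹ * mean (halfWord (byParity νh νv i) (byParity ph pv i) (axisLetter i false)) φ := by
  rw [halfCycleLaw, mean_bind, mean_uniform_bool]

theorem mem_support_zigzag {ν : PMF ℕ+} {l : Letter} {g : ℕ} {c : List Letter}
    (hc : c ∈ (zigzag ν l g).support) :
    g ≤ c.length ∧ ∀ x ∈ c, (x.IsHorizontal ↔ l.IsHorizontal) := by
  induction g generalizing l c with
  | zero =>
    rw [zigzag, PMF.mem_support_pure_iff] at hc
    simp [hc]
  | succ g ih =>
    rw [zigzag, PMF.mem_support_bind_iff] at hc
    obtain ⟨t, -, hc⟩ := hc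
    obtain ⟨c', hc', rfl⟩ := (PMF.mem_support_map_iff _ _ _).1 hc
    obtain ⟨h1, h2⟩ := ih hc'
    have ht := t.pos
    refine ⟨by simp; omega, fun x hx => ?_⟩
    rcases List.mem_append.1 hx with hx | hx
    · rw [List.eq_of_mem_replicate hx]
    · rw [h2 x hx, Letter.opp_isHorizontal_iff]

theorem isAxisWord_of_mem_support {i : ℕ} {c : List Letter}
    (hc : c ∈ (halfCycleLaw νh νv ph pv i).support) : IsAxisWord i c := by
  rw [halfCycleLaw, PMF.mem_support_bind_iff] at hc
  obtain ⟨b, -, hc⟩ := hc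
  rw [halfWord, PMF.mem_support_bind_iff] at hc
  obtain ⟨j, -, hc⟩ := hc
  obtain ⟨h1, h2⟩ := mem_support_zigzag hc
  refine ⟨fun h => by simp [h] at h1, fun x hx => ?_⟩
  rw [h2 x hx, axisLetter_isHorizontal_iff]

theorem map_eval_wordMeasure (i : ℕ) :
    (wordMeasure νh νv ph pv).map (fun ω => ω i) = (halfCycleLaw νh νv ph pv i).toMeasure :=
  Measure.infinitePi_map_eval _ i

theorem ae_isAxisWord : ∀ᵐ ω ∂wordMeasure νh νv ph pv, ∀ i, IsAxisWord i (ω i) := by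
  rw [ae_all_iff]
  intro i
  have h : ∀ᵐ c ∂(wordMeasure νh νv ph pv).map (fun ω => ω i), IsAxisWord i c := by
    rw [map_eval_wordMeasure, ae_iff, PMF.toMeasure_apply_eq_zero_iff _ .of_discrete]
    exact Set.disjoint_left.2 fun c hc h => h (isAxisWord_of_mem_support νh νv ph pv hc)
  exact ae_of_ae_map (measurable_pi_apply i).aemeasurable h

theorem iIndepFun_words : iIndepFun (fun (i : ℕ) (ω : ℕ → List Letter) => ω i)
    (wordMeasure νh νv ph pv) :=
  iIndepFun_infinitePi (X := fun _ x => x) (by fun_prop)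

theorem measurable_jump (d k : ℕ) : Measurable (jump d k) :=
  (Measurable.of_discrete (f := fun c : List Letter => along d (disp c))).comp
    (measurable_pi_apply (2 * k + d))

theorem iIndepFun_jump (d : ℕ) : iIndepFun (jump d) (wordMeasure νh νv ph pv) :=
  ((iIndepFun_words νh νv ph pv).precomp (g := fun k => 2 * k + d) fun i j h => by
    simpa using h).comp (fun _ c => along d (disp c)) fun _ => .of_discrete

/-- The displacements of the half-cycles are the jumps of the walks `H` and `V`. -/
theorem map_jump {d : ℕ} (k : ℕ) : (wordMeasure νh νv ph pv).map (jump d k) =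
    jumpLaw (byParity νh νv d) (byParity ph pv d) := by
  have h := map_eval_wordMeasure νh νv ph pv (2 * k + d)
  rw [halfCycleLaw_two_mul_add] at h
  have hj : jump d k = (fun c => along d (disp c)) ∘ fun ω => ω (2 * k + d) := rfl
  rw [hj, ← Measure.map_map .of_discrete (by fun_prop), h]
  refine Measure.ext fun A _ => ?_
  rw [Measure.map_apply .of_discrete .of_discrete, toMeasure_apply_eq_mean, mean_halfCycleLaw,
    jumpLaw_apply]
  have hφ : ((fun c => along d (disp c)) ⁻¹' A).indicator (1 : List Letter → ℝ≥0∞) =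
      fun c => (fun x => A.indicator 1 (along d x)) (disp c) := rfl
  simp only [hφ, halfWord, mean_bind]
  simp only [mean_zigzag_disp _ _ fun x => A.indicator 1 (along d x), along_axisLetter]
  congr! 8 with j z
  rw [show axisLetter d false = (axisLetter d true).opp by rw [axisLetter_opp]; rfl,
    Letter.dir_opp, smul_neg, ← neg_smul, along_axisLetter]

theorem visits_opp_iff (l : Letter) (z : ℤ) (c : List Letter) :
    Visits l.opp z c ↔ Visits l (-z) c := by
  simp only [Visits, Letter.dir_opp, smul_neg, neg_smul]

open Classical in
/-- A half-cycle meets `z` with a probability comparable to that of a jump beyond `z`. -/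
theorem halfCycleLaw_visits_le {d : ℕ} (hp : byParity ph pv d < 1) (z : ℤ) :
    (halfCycleLaw νh νv ph pv d).toMeasure {c | Visits (axisLetter d true) z c} ≤
      (ENNReal.ofReal (1 - byParity ph pv d))⁻¹ *
        jumpLaw (byParity νh νv d) (byParity ph pv d) {x | Beyond z x} := by
  have hind (s : Set (List Letter)) : s.indicator (1 : List Letter → ℝ≥0∞) =
      fun c => if c ∈ s then 1 else 0 := rfl
  have hind' (s : Set ℤ) : s.indicator (1 : ℤ → ℝ≥0∞) = fun c => if c ∈ s then 1 else 0 := rfl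
  have hB (x : ℤ) : Beyond z (-x) ↔ Beyond (-z) x := by unfold Beyond; omega
  rw [toMeasure_apply_eq_mean, mean_halfCycleLaw, jumpLaw_apply, hind, hind', mul_add]
  simp only [Set.mem_ofPred_eq, hB]
  refine add_le_add ?_ ?_
  · rw [mul_left_comm]
    gcongr
    exact mean_halfWord_visits_le hp _ z
  · rw [mul_left_comm]
    gcongr
    refine le_trans (le_of_eq ?_) (mean_halfWord_visits_le hp (axisLetter d false) (-z))
    congr 1
    ext c
    rw [show axisLetter d false = (axisLetter d true).opp by rw [axisLetter_opp]; rfl,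
      visits_opp_iff, neg_neg]

/-- The horizontal half-cycles and the vertical ones are independent. -/
theorem indepFun_words_of_parity {d : ℕ} (hd : d ≤ 1) :
    IndepFun (fun (ω : ℕ → List Letter) (k : ℕ) => ω (2 * k + (1 - d)))
      (fun ω k => ω (2 * k + d)) (wordMeasure νh νv ph pv) := by
  have hcomap (e : ℕ) : MeasurableSpace.comap
      (fun (ω : ℕ → List Letter) (k : ℕ) => ω (2 * k + e)) inferInstance ≤
      ⨆ i ∈ {i | Even i ↔ Even e}, MeasurableSpace.comap (fun ω : ℕ → List Letter => ω i) ⊤ := by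
    rw [MeasurableSpace.pi, MeasurableSpace.comap_iSup]
    refine iSup_le fun k => ?_
    rw [MeasurableSpace.comap_comp]
    exact le_iSup₂_of_le (2 * k + e) (by simp [Nat.even_add]) le_rfl
  rw [IndepFun_iff_Indep]
  refine indep_of_indep_of_le_left (indep_of_indep_of_le_right ?_ (hcomap d)) (hcomap (1 - d))
  refine indep_iSup_of_disjoint (fun i => (measurable_pi_apply i).comap_le)
    (iIndepFun_words νh νv ph pv).iIndep ?_
  refine Set.disjoint_left.2 fun i hi hj => ?_
  simp only [Set.mem_ofPred_eq] at hi hj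
  rw [hi] at hj
  interval_cases d <;> simp at hj

theorem beyond_crossProb_le {κ : Measure ℤ} [IsProbabilityMeasure κ] (hκ : κ.map Neg.neg = κ)
    (n : ℕ) : ((convPow κ n).prod κ) {p | Beyond (-p.1) p.2} ≤ 2 * crossProb κ n := by
  have h1 : ((convPow κ n).prod κ) {p | 0 ≤ -p.1 ∧ -p.1 ≤ p.2} = crossProb κ n :=
    prod_neg_left_apply (map_neg_convPow hκ n) {p | 0 ≤ p.1 ∧ p.1 ≤ p.2}
  have h2 : ((convPow κ n).prod κ) {p | 0 ≤ p.1 ∧ p.1 ≤ -p.2} = crossProb κ n :=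
    prod_neg_right_apply hκ {p | 0 ≤ p.1 ∧ p.1 ≤ p.2}
  calc _ ≤ ((convPow κ n).prod κ) ({p | 0 ≤ -p.1 ∧ -p.1 ≤ p.2} ∪ {p | 0 ≤ p.1 ∧ p.1 ≤ -p.2}) := by
        refine measure_mono fun p hp => ?_
        simp only [Set.mem_union, Set.mem_ofPred_eq, Beyond] at hp ⊢
        omega
    _ ≤ _ := measure_union_le _ _
    _ = _ := by rw [h1, h2, two_mul]

/-- During the half-cycle number `2 * n + d`, the walk visits the origin only if the walk on the
other axis is there, and with a probability comparable to that of a crossing in one jump. -/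
theorem measure_segmentHits_le {d : ℕ} (hd : d ≤ 1) (hp : byParity ph pv d < 1) (n : ℕ) :
    wordMeasure νh νv ph pv {ω | SegmentHits (2 * n + d) ω} ≤
      (2 * (ENNReal.ofReal (1 - byParity ph pv d))⁻¹) *
        (convPow (jumpLaw (byParity νh νv (1 - d)) (byParity ph pv (1 - d))) (n + d) {0} *
          crossProb (jumpLaw (byParity νh νv d) (byParity ph pv d)) n) := by
  set Q := wordMeasure νh νv ph pv with hQ
  set κ := jumpLaw (byParity νh νv d) (byParity ph pv d) with hκ
  set C := (ENNReal.ofReal (1 - byParity ph pv d))⁻¹ with hC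
  have hsum (e m : ℕ) : Measurable fun x : ℕ → List Letter =>
      ∑ k ∈ Finset.range m, along e (disp (x k)) :=
    Finset.measurable_fun_sum _ fun k _ =>
      (Measurable.of_discrete (f := fun c : List Letter => along e (disp c))).comp
        (measurable_pi_apply k)
  set A₁ : Set (ℕ → List Letter) :=
    {x | ∑ k ∈ Finset.range (n + d), along (1 - d) (disp (x k)) = 0} with hA₁
  set A₂ : Set (ℕ → List Letter) :=
    {x | Visits (axisLetter d true) (-∑ k ∈ Finset.range n, along d (disp (x k))) (x n)} with hA₂
  have hm₁ : MeasurableSet A₁ := hsum _ _ (MeasurableSet.of_discrete (s := {0}))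
  have hm₂ : MeasurableSet A₂ := ((hsum d n).prodMk (measurable_pi_apply n))
    (MeasurableSet.of_discrete (s := {p : ℤ × List Letter | Visits (axisLetter d true) (-p.1) p.2}))
  have h1 : Q {ω | SegmentHits (2 * n + d) ω} = Q ((fun ω k => ω (2 * k + (1 - d))) ⁻¹' A₁ ∩
      (fun ω k => ω (2 * k + d)) ⁻¹' A₂) := by
    refine measure_congr ?_
    filter_upwards [ae_isAxisWord νh νv ph pv] with ω hω
    exact propext (segmentHits_iff hω hd n)
  have h2 : Q ((fun ω k => ω (2 * k + (1 - d))) ⁻¹' A₁) =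
      convPow (jumpLaw (byParity νh νv (1 - d)) (byParity ph pv (1 - d))) (n + d) {0} := by
    rw [← map_sum_range_eq_convPow (measurable_jump (1 - d)) (iIndepFun_jump νh νv ph pv (1 - d))
      (map_jump νh νv ph pv), Measure.map_apply
        (Finset.measurable_fun_sum _ fun i _ => measurable_jump _ i) .of_discrete]
    rfl
  have hpair : Q.map (fun ω => (∑ k ∈ Finset.range n, jump d k ω, ω (2 * n + d))) =
      (convPow κ n).prod (halfCycleLaw νh νv ph pv d).toMeasure := by
    have hi : iIndepFun (fun k (ω : ℕ → List Letter) => ω (2 * k + d)) Q :=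
      (iIndepFun_words νh νv ph pv).precomp (g := fun k => 2 * k + d) fun i j h => by simpa using h
    have h := (hi.indepFun_finset (Finset.range n) {n} (by simp) (by fun_prop)).comp
      (φ := fun x => ∑ i, along d (disp (x i)))
      (ψ := fun x => x ⟨n, Finset.mem_singleton_self n⟩)
      (Finset.measurable_fun_sum _ fun i _ => by
        exact (Measurable.of_discrete (f := fun c : List Letter => along d (disp c))).comp
          (measurable_pi_apply i))
      (measurable_pi_apply (X := fun _ => List Letter)
        (⟨n, Finset.mem_singleton_self n⟩ : ({n} : Finset ℕ)))
    have h' : IndepFun (fun ω => ∑ k ∈ Finset.range n, jump d k ω) (fun ω => ω (2 * n + d)) Q := by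
      convert! h using 1
      ext ω
      exact (Finset.sum_coe_sort (Finset.range n) fun k => jump d k ω).symm
    rw [(indepFun_iff_map_prod_eq_prod_map_map
      (Finset.measurable_fun_sum _ fun i _ => measurable_jump _ i).aemeasurable
      (measurable_pi_apply (2 * n + d)).aemeasurable).1 h', map_sum_range_eq_convPow (measurable_jump d)
      (iIndepFun_jump νh νv ph pv d) (map_jump νh νv ph pv), map_eval_wordMeasure,
      halfCycleLaw_two_mul_add]
  have h3 : Q ((fun ω k => ω (2 * k + d)) ⁻¹' A₂) ≤ (2 * C) * crossProb κ n := by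
    have : (fun (ω : ℕ → List Letter) (k : ℕ) => ω (2 * k + d)) ⁻¹' A₂ =
        (fun ω => (∑ k ∈ Finset.range n, jump d k ω, ω (2 * n + d))) ⁻¹'
          {p | Visits (axisLetter d true) (-p.1) p.2} := rfl
    rw [this, ← Measure.map_apply ((Finset.measurable_fun_sum _ fun i _ =>
      measurable_jump _ i).prodMk (by fun_prop)) .of_discrete, hpair,
      Measure.prod_apply .of_discrete]
    calc ∫⁻ v, _ ∂(convPow κ n) ≤ ∫⁻ v, C * κ {x | Beyond (-v) x} ∂(convPow κ n) :=
          lintegral_mono fun v => halfCycleLaw_visits_le νh νv ph pv hp (-v)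
      _ = C * ((convPow κ n).prod κ) {p | Beyond (-p.1) p.2} := by
          rw [lintegral_const_mul _ .of_discrete, Measure.prod_apply .of_discrete]
          rfl
      _ ≤ C * (2 * crossProb κ n) := by
          gcongr
          exact beyond_crossProb_le (map_neg_jumpLaw _ _) n
      _ = _ := by ring
  rw [h1, (indepFun_words_of_parity νh νv ph pv hd).measure_inter_preimage_eq_mul _ _ hm₁ hm₂, h2]
  calc _ ≤ _ := mul_le_mul_right h3 _
    _ = _ := by ring

theorem measurable_concat (n : ℕ) : Measurable fun ω : ℕ → List Letter => concat ω n := by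
  induction n with
  | zero => exact measurable_const
  | succ n ih =>
    simp only [concat_succ]
    exact (Measurable.of_discrete (f := fun p : List Letter × List Letter => p.1 ++ p.2)).comp
      (ih.prodMk (measurable_pi_apply n))

theorem measurableSet_segmentHits (i : ℕ) : MeasurableSet {ω | SegmentHits i ω} := by
  exact ((measurable_concat i).prodMk (measurable_pi_apply i)) (MeasurableSet.of_discrete
    (s := {p : List Letter × List Letter | ∃ k ≤ p.2.length, disp p.1 + disp (p.2.take k) = 0}))

theorem measurableSet_frequently_segmentHits :
    MeasurableSet {ω | ∃ᶠ i in atTop, SegmentHits i ω} := by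
  have := MeasurableSet.measurableSet_limsup fun i => measurableSet_segmentHits i
  convert this using 1
  ext ω
  rw [Filter.mem_limsup_iff_frequently_mem]
  rfl

/-- Divergence of one of the series makes the walk visit the origin during infinitely many words
with positive probability. -/
theorem measure_frequently_segmentHits_ne_zero {d : ℕ} (hd : d ≤ 1)
    (hsum : ∑' n, convPow (jumpLaw (byParity νh νv (1 - d)) (byParity ph pv (1 - d))) (n + 1) {0} *
      crossProb (jumpLaw (byParity νh νv d) (byParity ph pv d)) n = ∞) :
    wordMeasure νh νv ph pv {ω | ∃ᶠ i in atTop, SegmentHits i ω} ≠ 0 := by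
  have hind := (indepFun_words_of_parity νh νv ph pv hd).comp
    (φ := fun x k => along (1 - d) (disp (x k))) (ψ := fun x k => along d (disp (x k)))
    (measurable_pi_lambda _ fun k =>
      (Measurable.of_discrete (f := fun c : List Letter => along (1 - d) (disp c))).comp
        (measurable_pi_apply k))
    (measurable_pi_lambda _ fun k =>
      (Measurable.of_discrete (f := fun c : List Letter => along d (disp c))).comp
        (measurable_pi_apply k))
  have h := measure_limsup_crossing_ne_zero (map_neg_jumpLaw _ _) (measurable_jump (1 - d))
    (iIndepFun_jump νh νv ph pv (1 - d)) (map_jump νh νv ph pv) (measurable_jump d)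
    (iIndepFun_jump νh νv ph pv d) (map_jump νh νv ph pv) hind d hd hsum
  refine fun h0 => h (measure_mono_null_ae ?_ h0)
  filter_upwards [ae_isAxisWord νh νv ph pv] with ω hω hmem
  replace hmem := Filter.mem_limsup_iff_frequently_mem.1 hmem
  change ∃ᶠ i in atTop, SegmentHits i ω
  rw [frequently_atTop]
  intro N
  obtain ⟨n, hn, h1, h2, h3⟩ := frequently_atTop.1 hmem N
  refine ⟨2 * n + d, by omega, (segmentHits_iff hω hd n).2 ⟨h1, ?_⟩⟩
  refine visits_of_between (fun x hx => ?_) h2 h3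
  rw [(hω _).2 x hx]
  simp [Nat.even_add]

/-- Visiting the origin infinitely often is an event of probability zero or one, since it does not
depend on the order of finitely many cycles. -/
theorem measure_frequently_segmentHits_eq_zero_or_one :
    wordMeasure νh νv ph pv {ω | ∃ᶠ i in atTop, SegmentHits i ω} = 0 ∨
      wordMeasure νh νv ph pv {ω | ∃ᶠ i in atTop, SegmentHits i ω} = 1 := by
  refine measure_eq_zero_or_one_of_exchangeable _ measurableSet_frequently_segmentHits fun N => ?_
  -- The permutation exchanges the blocks `[0, 2 * N)` and `[2 * N, 4 * N)`.
  set f : ℕ → ℕ := fun i =>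
    if i < 2 * N then 2 * N + i else if i < 4 * N then i - 2 * N else i with hf
  have hinv : Function.Involutive f := fun i => by
    simp only [hf]
    split_ifs <;> omega
  refine ⟨hinv.toPerm f, fun i => ?_, fun i hi => ?_, ?_⟩
  · simp only [Function.Involutive.coe_toPerm, hf]
    split_ifs with h1 h2
    · rw [halfCycleLaw_two_mul_add]
    · obtain ⟨j, rfl⟩ := exists_add_of_le (not_lt.1 h1)
      rw [Nat.add_sub_cancel_left, halfCycleLaw_two_mul_add]
    · rfl
  · simp only [Function.Involutive.coe_toPerm, hf]
    split_ifs <;> omega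
  · ext ω
    refine frequently_congr ?_
    filter_upwards [eventually_ge_atTop (4 * N)] with i hi
    have hfi : f i = i := by simp only [hf]; split_ifs <;> omega
    simp only [SegmentHits, Function.Involutive.coe_toPerm, hfi, disp_concat]
    have : ∑ j ∈ Finset.range i, disp (ω (f j)) = ∑ j ∈ Finset.range i, disp (ω j) := by
      refine Finset.sum_equiv (hinv.toPerm f) (fun j => ?_) fun j _ => rfl
      simp only [Finset.mem_range, Function.Involutive.coe_toPerm, hf]
      split_ifs <;> omega
    rw [this]

end Model

/-! ### The law of the concatenated half-cycles -/

theorem byAxis_axisLetter {T : Type*} (a b : T) (i : ℕ) (c : Bool) :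
    byAxis a b (axisLetter i c) = byParity a b i := by
  rw [byAxis, byParity]
  simp only [axisLetter_isHorizontal_iff]

/-- The indicator of the words starting with `w`. -/
def hasPrefix (w c : List Letter) : ℝ≥0∞ := if w <+: c then 1 else 0

@[simp]
theorem hasPrefix_nil (c : List Letter) : hasPrefix [] c = 1 := by simp [hasPrefix]

@[simp]
theorem hasPrefix_cons_cons (m l : Letter) (w c : List Letter) :
    hasPrefix (m :: w) (l :: c) = if m = l then hasPrefix w c else 0 := by
  simp only [hasPrefix, List.cons_prefix_cons]
  split_ifs <;> simp_all

/-- The probability that a persistence time with law `ν` is at least `a`. -/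
noncomputable def survivalOf (ν : PMF ℕ+) (a : ℕ+) : ℝ≥0∞ := mean ν fun t => if a ≤ t then 1 else 0

section Model

variable (νh νv : PMF ℕ+) (ph pv : unitInterval)

/-- The probability that a change of direction from `l` leads to `m ≠ l`. -/
noncomputable def turnWeight (l m : Letter) : ℝ≥0∞ :=
  if m = l.opp then ENNReal.ofReal (byAxis ph pv l : unitInterval) else
    ENNReal.ofReal ((1 - (byAxis ph pv l : unitInterval)) / 2)

/-- The probability that, after a change of direction, the letter `l` is written at least `a` times
and that these `a` letters are followed by the word `w`. -/
noncomputable def wordWeight : Letter → ℕ+ → List Letter → ℝ≥0∞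
  | l, a, [] => survivalOf (byAxis νh νv l) a
  | l, a, m :: w => if m = l then wordWeight l (a + 1) w else
      byAxis νh νv l a * turnWeight ph pv l m * wordWeight m 1 w

/-- The concatenation of the `N` half-cycles from the number `i` on. -/
noncomputable def halfCycles : ℕ → ℕ → PMF (List Letter)
  | _, 0 => PMF.pure []
  | i, N + 1 => (halfCycleLaw νh νv ph pv i).bind fun c => (halfCycles (i + 1) N).map (c ++ ·)

/-- The word written from the start of a run in direction `axisLetter i b` during the half-cycle
number `i`, until `N` further half-cycles are completed. -/
noncomputable def fromRun (i : ℕ) (b : Bool) (N : ℕ) : PMF (List Letter) :=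
  (halfWord (byParity νh νv i) (byParity ph pv i) (axisLetter i b)).bind fun c =>
    (halfCycles νh νv ph pv (i + 1) N).map (c ++ ·)

/-- The expectation of a function of what follows a run in direction `axisLetter i b`. -/
noncomputable def afterRun (i : ℕ) (b : Bool) (N : ℕ) (φ : List Letter → ℝ≥0∞) : ℝ≥0∞ :=
  ENNReal.ofReal (1 - byParity ph pv i) * mean (halfCycles νh νv ph pv (i + 1) N) φ +
    ENNReal.ofReal (byParity ph pv i : unitInterval) * mean (fromRun νh νv ph pv i (!b) N) φ

/-- The last half-cycle may be split off instead of the first one. -/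
theorem halfCycles_succ_eq_bind (i N : ℕ) : halfCycles νh νv ph pv i (N + 1) =
    (halfCycles νh νv ph pv i N).bind fun c =>
      (halfCycleLaw νh νv ph pv (i + N)).map (c ++ ·) := by
  induction N generalizing i with
  | zero =>
    simp only [halfCycles, PMF.map, PMF.pure_bind, Function.comp_def, List.append_nil,
      List.nil_append, add_zero]
  | succ N ih =>
    change ((halfCycleLaw νh νv ph pv i).bind fun c =>
      (halfCycles νh νv ph pv (i + 1) (N + 1)).map (c ++ ·)) =
      ((halfCycleLaw νh νv ph pv i).bind fun c =>
        (halfCycles νh νv ph pv (i + 1) N).map (c ++ ·)).bind _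
    rw [ih]
    simp only [PMF.map_bind, PMF.bind_bind, PMF.bind_map, PMF.map_comp, Function.comp_def,
      List.append_assoc, show i + 1 + N = i + (N + 1) by ring]

theorem map_concat (N : ℕ) : (wordMeasure νh νv ph pv).map (fun ω => concat ω N) =
    (halfCycles νh νv ph pv 0 N).toMeasure := by
  induction N with
  | zero => simp [concat, halfCycles, Measure.map_const, PMF.toMeasure_pure]
  | succ N ih =>
    have hind : IndepFun (fun ω : ℕ → List Letter => concat ω N) (fun ω => ω N)
        (wordMeasure νh νv ph pv) := by
      have h := ((iIndepFun_words νh νv ph pv).indepFun_finset (Finset.range N) {N} (by simp)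
        (by fun_prop)).comp
        (φ := fun x : Finset.range N → List Letter =>
          (List.range N).flatMap fun k => if hk : k ∈ Finset.range N then x ⟨k, hk⟩ else [])
        (ψ := fun x => x ⟨N, Finset.mem_singleton_self N⟩) .of_discrete
        (measurable_pi_apply (X := fun _ => List Letter)
          (⟨N, Finset.mem_singleton_self N⟩ : ({N} : Finset ℕ)))
      convert! h using 1
      ext1 ω
      exact List.flatMap_congr fun k hk => by simp [List.mem_range.1 hk]
    have hpair := (indepFun_iff_map_prod_eq_prod_map_map (measurable_concat N).aemeasurable
      (measurable_pi_apply N).aemeasurable).1 hind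
    rw [ih, map_eval_wordMeasure] at hpair
    have hcomp : (fun ω : ℕ → List Letter => concat ω (N + 1)) =
        (fun p : List Letter × List Letter => p.1 ++ p.2) ∘ fun ω => (concat ω N, ω N) := by
      ext1 ω; exact concat_succ ω N
    rw [hcomp, ← Measure.map_map .of_discrete ((measurable_concat N).prodMk (measurable_pi_apply N)),
      hpair]
    refine Measure.ext fun A _ => ?_
    rw [Measure.map_apply .of_discrete .of_discrete, Measure.prod_apply .of_discrete,
      lintegral_toMeasure_eq_mean, toMeasure_apply_eq_mean, halfCycles_succ_eq_bind, mean_bind,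
      zero_add]
    congr 1
    ext c
    rw [toMeasure_apply_eq_mean, mean_map]
    rfl

variable {ph pv}

theorem byParity_lt_one (hph : ph < 1) (hpv : pv < 1) (i : ℕ) : byParity ph pv i < 1 := by
  unfold byParity; split_ifs <;> assumption

theorem mean_halfCycles_succ (i N : ℕ) (φ : List Letter → ℝ≥0∞) :
    mean (halfCycles νh νv ph pv i (N + 1)) φ =
      2⁻¹ * mean (fromRun νh νv ph pv i true N) φ +
        2⁻¹ * mean (fromRun νh νv ph pv i false N) φ := by
  rw [halfCycles, mean_bind, mean_halfCycleLaw]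
  simp only [fromRun, mean_bind]

/-- The first run of `fromRun` has law `byParity νh νv i` and is independent of what follows. -/
theorem mean_fromRun {i : ℕ} (hp : byParity ph pv i < 1) (b : Bool) (N : ℕ)
    (φ : List Letter → ℝ≥0∞) : mean (fromRun νh νv ph pv i b N) φ =
      mean (byParity νh νv i) fun t => afterRun νh νv ph pv i b N fun c =>
        φ (List.replicate t (axisLetter i b) ++ c) := by
  rw [fromRun, mean_bind, mean_halfWord hp]
  simp only [afterRun, fromRun, mean_bind, mean_map, axisLetter_opp, List.append_assoc]

theorem afterRun_const {i : ℕ} (b : Bool) (N : ℕ) (c : ℝ≥0∞) :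
    afterRun νh νv ph pv i b N (fun _ => c) = c := by
  rw [afterRun, mean_const, mean_const, ← add_mul,
    ← ENNReal.ofReal_add (sub_nonneg.2 (byParity ph pv i).2.2) (byParity ph pv i).2.1]
  simp

/-- After a run, the walk either leaves the axis, in a direction chosen by a fair coin, or makes a
U-turn; this agrees with `turnWeight`. -/
theorem turnWeight_axisLetter (i : ℕ) (b : Bool) (m : Letter) (W : ℝ≥0∞) :
    ENNReal.ofReal (1 - byParity ph pv i) *
        (2⁻¹ * (if m = axisLetter (i + 1) true then W else 0) +
          2⁻¹ * (if m = axisLetter (i + 1) false then W else 0)) +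
      ENNReal.ofReal (byParity ph pv i : unitInterval) * (if m = axisLetter i (!b) then W else 0) =
    if m = axisLetter i b then 0 else turnWeight ph pv (axisLetter i b) m * W := by
  have hhalf : ENNReal.ofReal ((1 - byParity ph pv i) / 2) =
      ENNReal.ofReal (1 - byParity ph pv i) * 2⁻¹ := by
    rw [ENNReal.ofReal_div_of_pos (by norm_num), ENNReal.div_eq_inv_mul, mul_comm]
    norm_num
  rw [turnWeight, axisLetter_opp, byAxis_axisLetter, hhalf]
  by_cases hi : Even i <;> cases b <;> cases m <;>
    simp [axisLetter, hi, Nat.even_add_one, -Nat.not_even_iff_odd, mul_assoc]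

theorem mean_fromRun_hasPrefix_cons {i : ℕ} (hp : byParity ph pv i < 1) (b : Bool) (N : ℕ)
    (m : Letter) (w : List Letter) :
    mean (fromRun νh νv ph pv i b N) (hasPrefix (m :: w)) =
      if m = axisLetter i b then
        mean (byParity νh νv i) fun t => if 1 ≤ t then afterRun νh νv ph pv i b N fun c =>
          hasPrefix w (List.replicate (t - (1 : ℕ+) : ℕ) (axisLetter i b) ++ c) else 0
      else 0 := by
  rw [mean_fromRun νh νv hp]
  have hrep (t : ℕ+) : List.replicate (t : ℕ) (axisLetter i b) =
      axisLetter i b :: List.replicate (t - (1 : ℕ+) : ℕ) (axisLetter i b) := by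
    rw [← List.replicate_succ, PNat.one_coe, Nat.sub_add_cancel t.pos]
  simp only [hrep, List.cons_append, hasPrefix_cons_cons, one_le, if_true]
  split_ifs with h
  · rfl
  · simp only [afterRun_const, mean_const]

/-- After `a` letters of a run, the next letters form the word `w` with probability
`wordWeight l a w`. The number of half-cycles taken into account only has to be large enough for
the word `w` to be completed. -/
theorem mean_afterRun_hasPrefix (hph : ph < 1) (hpv : pv < 1) (w : List Letter) (i : ℕ) (b : Bool)
    (N : ℕ) (hN : w.length ≤ N) (a : ℕ+) :
    (mean (byParity νh νv i) fun t => if a ≤ t then afterRun νh νv ph pv i b N fun c =>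
      hasPrefix w (List.replicate (t - a : ℕ) (axisLetter i b) ++ c) else 0) =
      wordWeight νh νv ph pv (axisLetter i b) a w := by
  induction w generalizing i b N a with
  | nil => simp [wordWeight, survivalOf, afterRun_const, byAxis_axisLetter]
  | cons m w ih =>
    have fresh (j : ℕ) (b' : Bool) (M : ℕ) (hM : w.length ≤ M) :
        mean (fromRun νh νv ph pv j b' M) (hasPrefix (m :: w)) =
          if m = axisLetter j b' then wordWeight νh νv ph pv m 1 w else 0 := by
      rw [mean_fromRun_hasPrefix_cons νh νv (byParity_lt_one hph hpv j), ih j b' M hM 1]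
      split_ifs with h
      · rw [h]
      · rfl
    obtain ⟨N, rfl⟩ : ∃ M, N = M + 1 := ⟨N - 1, by simp at hN; omega⟩
    simp only [List.length_cons, add_le_add_iff_right] at hN
    have hafter : afterRun νh νv ph pv i b (N + 1) (hasPrefix (m :: w)) =
        if m = axisLetter i b then 0 else
          turnWeight ph pv (axisLetter i b) m * wordWeight νh νv ph pv m 1 w := by
      rw [afterRun, mean_halfCycles_succ, fresh _ _ _ hN, fresh _ _ _ hN, fresh _ _ _ (by omega),
        turnWeight_axisLetter]
    have hstep (t : ℕ+) (h : a < t) : List.replicate (t - a : ℕ) (axisLetter i b) =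
        axisLetter i b :: List.replicate (t - (a + 1 : ℕ+) : ℕ) (axisLetter i b) := by
      rw [← List.replicate_succ]
      congr 1
      have : (a : ℕ) < t := h
      push_cast
      omega
    rw [wordWeight]
    split_ifs with hm
    · rw [← ih i b (N + 1) (by omega) (a + 1)]
      congr 1
      ext t
      rcases lt_trichotomy a t with h | h | h
      · rw [if_pos h.le, if_pos (PNat.add_one_le_iff.2 h)]
        simp only [hstep t h, List.cons_append, hasPrefix_cons_cons, if_pos hm]
      · subst h
        rw [if_pos le_rfl, if_neg (by rw [PNat.add_one_le_iff]; exact lt_irrefl _)]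
        simp only [Nat.sub_self, List.replicate_zero, List.nil_append]
        exact hafter.trans (if_pos hm)
      · rw [if_neg h.not_ge, if_neg fun h' => h.not_ge ((PNat.add_one_le_iff.1 h').le)]
    · rw [byAxis_axisLetter, mean, tsum_eq_single a]
      · rw [if_pos le_rfl]
        simp only [Nat.sub_self, List.replicate_zero, List.nil_append]
        have := hafter
        rw [if_neg hm] at this
        rw [mul_assoc, ← this]
      · intro t ht
        rcases lt_or_gt_of_ne ht with h | h
        · rw [if_neg h.not_ge, mul_zero]
        · simp only [hstep t h, List.cons_append, hasPrefix_cons_cons, if_neg hm, afterRun_const,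
            ite_self, mul_zero]

theorem mean_fromRun_hasPrefix (hph : ph < 1) (hpv : pv < 1) (m : Letter) (w : List Letter) (i : ℕ)
    (b : Bool) (N : ℕ) (hN : w.length ≤ N) :
    mean (fromRun νh νv ph pv i b N) (hasPrefix (m :: w)) =
      if m = axisLetter i b then wordWeight νh νv ph pv m 1 w else 0 := by
  rw [mean_fromRun_hasPrefix_cons νh νv (byParity_lt_one hph hpv i),
    mean_afterRun_hasPrefix νh νv hph hpv w i b N hN 1]
  split_ifs with h
  · rw [h]
  · rfl

open Classical in
/-- The probability that the path made of the half-cycles starts with a given word. -/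
theorem measure_initial_path (hph : ph < 1) (hpv : pv < 1) (m : Letter) (w : List Letter) :
    wordMeasure νh νv ph pv {ω | initial (path ω) (w.length + 1) = m :: w} =
      2⁻¹ * if m.IsHorizontal then wordWeight νh νv ph pv m 1 w else 0 := by
  have h1 : wordMeasure νh νv ph pv {ω | initial (path ω) (w.length + 1) = m :: w} =
      wordMeasure νh νv ph pv ((fun ω => concat ω (w.length + 1)) ⁻¹' {c | m :: w <+: c}) := by
    refine measure_congr ?_
    filter_upwards [ae_isAxisWord νh νv ph pv] with ω hω
    refine propext ?_
    change initial (path ω) (w.length + 1) = m :: w ↔ m :: w <+: concat ω (w.length + 1)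
    rw [initial_path (fun i => (hω i).1) (le_length_concat (fun i => (hω i).1) _),
      List.prefix_iff_eq_take, List.length_cons, eq_comm]
  rw [h1, ← Measure.map_apply (measurable_concat _) .of_discrete, map_concat,
    toMeasure_apply_eq_mean]
  have h2 : {c | m :: w <+: c}.indicator (1 : List Letter → ℝ≥0∞) = hasPrefix (m :: w) := by
    ext c
    by_cases hc : m :: w <+: c <;> simp [hasPrefix, hc]
  rw [h2, mean_halfCycles_succ, mean_fromRun_hasPrefix νh νv hph hpv _ _ _ _ _ le_rfl,
    mean_fromRun_hasPrefix νh νv hph hpv _ _ _ _ _ le_rfl, ← mul_add]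
  congr 1
  cases m <;> simp [axisLetter, Letter.IsHorizontal]

end Model

/-! ### The law of the letters of the chain -/

theorem pref_eq_run_iff {u : Word} {l l' : Letter} (h : l' ≠ l) (a : ℕ+) :
    pref u = .run l l' h a ↔ (∀ k < (a : ℕ), u k = l) ∧ u a = l' := by
  classical
  constructor
  · intro hu
    rw [pref] at hu
    split_ifs at hu with hex
    injection hu with h1 h2 h3
    subst h1 h2 h3
    exact ⟨fun k hk => not_not.1 (Nat.find_min hex hk), rfl⟩
  · rintro ⟨h1, h2⟩
    have h0 : u 0 = l := h1 0 a.pos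
    have hex : ∃ k, u k ≠ u 0 := ⟨a, by rw [h2, h0]; exact h⟩
    have hfind : Nat.find hex = a :=
      (Nat.find_eq_iff hex).2 ⟨by rw [h2, h0]; exact h, fun k hk => by simp [h1 k hk, h0]⟩
    have ha : a = ⟨Nat.find hex, hfind ▸ a.pos⟩ := PNat.eq hfind.symm
    rw [pref, dif_pos hex]
    subst h0 h2
    congr 1
    · rw [hfind]
    · exact ha.symm

theorem pref_append_self {u : Word} {l l' : Letter} {h : l' ≠ l} {a : ℕ+}
    (hu : pref u = .run l l' h a) : pref (u.append l) = .run l l' h (a + 1) := by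
  rw [pref_eq_run_iff] at hu ⊢
  refine ⟨fun k hk => ?_, hu.2⟩
  cases k with
  | zero => rfl
  | succ k => exact hu.1 k (by simpa using hk)

theorem pref_append_of_ne {u : Word} {m : Letter} (h : u 0 ≠ m) :
    pref (u.append m) = .run m (u 0) h 1 := by
  rw [pref_eq_run_iff]
  refine ⟨fun k hk => ?_, rfl⟩
  obtain rfl : k = 0 := by simpa using hk
  rfl

theorem eq_of_pref_eq_run {u : Word} {l l' : Letter} {h : l' ≠ l} {a : ℕ+}
    (hu : pref u = .run l l' h a) : u 0 = l := ((pref_eq_run_iff h a).1 hu).1 0 a.pos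

theorem survivalOf_one (ν : PMF ℕ+) : survivalOf ν 1 = 1 := by
  simp [survivalOf, mean_const]

theorem survivalOf_eq_add (ν : PMF ℕ+) (a : ℕ+) :
    survivalOf ν a = ν a + survivalOf ν (a + 1) := by
  have h : ν a = mean ν fun t => if t = a then 1 else 0 := by simp [mean]
  rw [h, survivalOf, survivalOf, ← mean_add]
  congr 1
  ext t
  rcases lt_trichotomy a t with h | h | h
  · simp [h.le, h, h.ne']
  · simp [h]
  · simp [h.not_ge, h.ne, h.le]

theorem survivalOf_ne_top (ν : PMF ℕ+) (a : ℕ+) : survivalOf ν a ≠ ∞ := by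
  refine ne_top_of_le_ne_top ENNReal.one_ne_top ?_
  refine (mean_mono fun t => ?_).trans_eq (mean_const ν 1)
  split_ifs <;> simp

section Transition

variable {q : ProbTree} {νh νv : PMF ℕ+} {ph pv : unitInterval}

theorem survival_add_one (q : ProbTree) {l l' : Letter} (h : l' ≠ l) (a : ℕ+) :
    survival q h (a + 1) = survival q h a * (1 - alpha q h a) := by
  have : Finset.Ico 1 (a + 1) = insert a (Finset.Ico 1 a) := by
    ext k
    simp only [Finset.mem_Ico, Finset.mem_insert, PNat.lt_add_one_iff, one_le, true_and]
    exact le_iff_eq_or_lt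
  rw [survival, this, Finset.prod_insert (by simp), mul_comm]
  rfl

/-- By the persistence condition, runs in a given direction have the survival function of
`byAxis νh νv l`. -/
theorem survival_eq (hq : IsGeneralizedDRRW q νh νv ph pv) {l l' : Letter}
    (h : Occurs ph pv l' l) (a : ℕ+) : survival q h.1 a = survivalOf (byAxis νh νv l) a := by
  induction a using PNat.recOn with
  | one => rw [survivalOf_one]; simp [survival]
  | succ a ih =>
    rw [survival_add_one, ENNReal.mul_sub fun _ _ => ih ▸ survivalOf_ne_top _ _, mul_one,
      hq.persistence l' l h.1 h a, ih, survivalOf_eq_add,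
      ENNReal.add_sub_cancel_left (PMF.apply_ne_top _ _)]

/-- The probability to write `l` at least `a` times and then to write `m`. -/
noncomputable def stepWeight (νh νv : PMF ℕ+) (ph pv : unitInterval) (l : Letter) (a : ℕ+)
    (m : Letter) : ℝ≥0∞ :=
  if m = l then survivalOf (byAxis νh νv l) (a + 1) else byAxis νh νv l a * turnWeight ph pv l m

theorem turnProb_of_orthogonal {l m : Letter} (h : m.Orthogonal l) :
    turnProb ph pv m = (1 - (byAxis ph pv l : unitInterval)) / 2 := by
  cases l <;> cases m <;> simp_all [Letter.Orthogonal, Letter.IsHorizontal, turnProb, byAxis]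

theorem turnWeight_of_orthogonal {l m : Letter} (h : m.Orthogonal l) :
    turnWeight ph pv l m = ENNReal.ofReal ((1 - (byAxis ph pv l : unitInterval)) / 2) := by
  rw [turnWeight, if_neg]
  rintro rfl
  cases l <;> simp [Letter.Orthogonal, Letter.IsHorizontal, Letter.opp] at h

/-- A direction is reversed with the probability that is left by the orthogonal directions. -/
theorem apply_opp_of_apply_orthogonal (r : PMF Letter) {l : Letter} {α c : ℝ≥0∞} (p : unitInterval)
    (hα : α = 1 - r l) (hc : c = ENNReal.ofReal ((1 - (p : ℝ)) / 2))
    (h : ∀ m : Letter, m.Orthogonal l → r m = α * c) :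
    r l.opp = α * ENNReal.ofReal p := by
  have hsum : r l + r l.opp + (α * c + α * c) = 1 := by
    rw [← r.tsum_coe, tsum_fintype, show (Finset.univ : Finset Letter) = {.e, .n, .w, .s} from rfl]
    have h' (m : Letter) (hm : ¬(m.IsHorizontal ↔ l.IsHorizontal)) : r m = α * c := h m hm
    cases l <;> simp [Letter.IsHorizontal] at h' <;> simp [Letter.opp, h'] <;> ring
  have hcc : c + c = ENNReal.ofReal (1 - (p : ℝ)) := by
    rw [hc, ← ENNReal.ofReal_add (by linarith [p.2.2]) (by linarith [p.2.2]), add_halves]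
  have hone : ENNReal.ofReal p + (c + c) = 1 := by
    rw [hcc, ← ENNReal.ofReal_add p.2.1 (by linarith [p.2.2])]
    simp
  have hαtop : α ≠ ∞ := hα ▸ ENNReal.sub_ne_top ENNReal.one_ne_top
  have hle : r l + α = 1 := by rw [hα, add_tsub_cancel_of_le (r.coe_le_one l)]
  have hctop : α * c + α * c ≠ ∞ := by
    have : c ≠ ∞ := hc ▸ ENNReal.ofReal_ne_top
    finiteness
  have h1 : r l + (r l.opp + (α * c + α * c)) = r l + (α * ENNReal.ofReal p + (α * c + α * c)) := by
    rw [← add_assoc, hsum, ← mul_add, ← mul_add, hone, mul_one, hle]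
  exact (ENNReal.add_left_inj hctop).1 ((ENNReal.add_right_inj (PMF.apply_ne_top _ _)).1 h1)

/-- At a context that can occur, the distribution of the next letter depends neither on the
previous direction nor on the tree `q`, but only on `νh`, `νv`, `ph` and `pv`. -/
theorem survivalOf_mul_apply (hq : IsGeneralizedDRRW q νh νv ph pv) {l l' : Letter}
    (h : Occurs ph pv l' l) {a : ℕ+} (ha : survivalOf (byAxis νh νv l) a ≠ 0) (m : Letter) :
    survivalOf (byAxis νh νv l) a * q (.run l l' h.1 a) m = stepWeight νh νv ph pv l a m := by
  have hs := survival_eq hq h a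
  have hα := hq.persistence l' l h.1 h a
  have hturn := hq.turn l' l h.1 h a (hs ▸ ha)
  rw [stepWeight]
  split_ifs with hm
  · rw [hm, ← survival_eq hq h (a + 1), survival_add_one, hs, alpha,
      ENNReal.sub_sub_cancel ENNReal.one_ne_top (PMF.coe_le_one _ _)]
  · have key : q (.run l l' h.1 a) m = alpha q h.1 a * turnWeight ph pv l m := by
      by_cases ho : m.Orthogonal l
      · rw [hturn m ho, turnProb_of_orthogonal ho, turnWeight_of_orthogonal ho]
      · obtain rfl : m = l.opp := by
          cases l <;> cases m <;> simp_all [Letter.Orthogonal, Letter.IsHorizontal, Letter.opp]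
        rw [turnWeight, if_pos rfl]
        exact apply_opp_of_apply_orthogonal _ _ rfl rfl fun m ho => by
          rw [hturn m ho, turnProb_of_orthogonal ho]
    rw [key, ← mul_assoc, ← hs, hα]

theorem wordWeight_eq_zero {l : Letter} {a : ℕ+} (ha : survivalOf (byAxis νh νv l) a = 0)
    (w : List Letter) : wordWeight νh νv ph pv l a w = 0 := by
  induction w generalizing a with
  | nil => exact ha
  | cons m w ih =>
    rw [survivalOf_eq_add, add_eq_zero] at ha
    rw [wordWeight]
    split_ifs
    · exact ih ha.2
    · rw [ha.1, zero_mul, zero_mul]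

end Transition

theorem initial_succ (x : ℕ → Letter) (n : ℕ) : initial x (n + 1) = initial x n ++ [x n] := by
  simp [initial, List.range_succ]

theorem initial_succ_eq_append_iff (x : ℕ → Letter) (n : ℕ) (u : List Letter) (m : Letter) :
    initial x (n + 1) = u ++ [m] ↔ initial x n = u ∧ x n = m := by
  rw [initial_succ, List.append_singleton_inj]

theorem take_initial (x : ℕ → Letter) {k n : ℕ} (h : k ≤ n) :
    (initial x n).take k = initial x k := by
  rw [initial, ← List.map_take, List.take_range, min_eq_left h, initial]

theorem measurable_initial {Ω : Type*} [MeasurableSpace Ω] {X : Ω → ℕ → Letter} (n : ℕ)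
    (hX : ∀ k < n, Measurable fun ω => X ω k) : Measurable fun ω => initial (X ω) n := by
  induction n with
  | zero => exact measurable_const
  | succ n ih =>
    simp only [initial_succ]
    exact (Measurable.of_discrete (f := fun p : List Letter × Letter => p.1 ++ [p.2])).comp
      ((ih fun k hk => hX k (by omega)).prodMk (hX n (by omega)))

section Chain

variable {Ω : Type*} [hΩ : MeasurableSpace Ω] {μ : Measure Ω} {q : ProbTree}
  {U : ℕ → Ω → Word}

/-- The letters `X₁, X₂, …` written by the chain, numbered from `0` on. -/
def letters (U : ℕ → Ω → Word) (ω : Ω) (k : ℕ) : Letter := U (k + 1) ω 0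

theorem measurable_letters (hU : IsVLMC μ q U) : Measurable (letters U) :=
  measurable_pi_lambda _ fun k => (measurable_pi_apply 0).comp (hU.measurable (k + 1))

variable [IsProbabilityMeasure μ]

/-- The transition probabilities of the chain, on the event that its first letters are those of
`u`. -/
theorem measure_initial_letters_append (hU : IsVLMC μ q U) {n : ℕ} (hn : 1 ≤ n) (u : List Letter)
    (m : Letter) {c : ℝ≥0∞} (hc : c ≠ ∞)
    (h : ∀ᵐ ω ∂μ, initial (letters U ω) n = u → q (pref (U n ω)) m = c) :
    μ {ω | initial (letters U ω) (n + 1) = u ++ [m]} =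
      μ {ω | initial (letters U ω) n = u} * c := by
  set A : Set Ω := {ω | initial (letters U ω) n = u} with hA
  set B : Set Ω := {ω | U (n + 1) ω 0 = m}
  have hmB : MeasurableSet B :=
    (measurable_pi_apply 0).comp (hU.measurable (n + 1)) (MeasurableSet.of_discrete (s := {m}))
  have hint : Integrable (B.indicator fun _ => (1 : ℝ)) μ := (integrable_const 1).indicator hmB
  have hset : {ω | initial (letters U ω) (n + 1) = u ++ [m]} = A ∩ B := by
    ext ω
    exact initial_succ_eq_append_iff _ _ _ _
  have htransition := hU.transition n hn m
  have h𝓕 : (⨆ k : Fin (n + 1), MeasurableSpace.comap (U k) inferInstance) ≤ hΩ :=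
    iSup_le fun k => (hU.measurable k).comap_le
  set 𝓕 : MeasurableSpace Ω := ⨆ k : Fin (n + 1), MeasurableSpace.comap (U k) inferInstance
  have hmA : MeasurableSet[𝓕] A := by
    refine @measurable_initial Ω 𝓕 (letters U) n (fun k hk => ?_) {u} .of_discrete
    have h1 : Measurable[𝓕] (U (k + 1)) :=
      (comap_measurable (U (k + 1))).mono
        (le_iSup (fun k : Fin (n + 1) => MeasurableSpace.comap (U k) inferInstance)
          ⟨k + 1, by omega⟩) le_rfl
    exact (measurable_pi_apply 0).comp h1
  have h1 := setIntegral_condExp h𝓕 hint hmA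
  rw [setIntegral_indicator hmB, setIntegral_const, smul_eq_mul, mul_one,
    setIntegral_congr_ae (g := fun _ => c.toReal) (h𝓕 _ hmA)] at h1
  · rw [setIntegral_const, smul_eq_mul] at h1
    rw [hset, ← ENNReal.toReal_eq_toReal_iff' (measure_ne_top _ _)
      (ENNReal.mul_ne_top (measure_ne_top _ _) hc), ENNReal.toReal_mul]
    exact h1.symm
  · filter_upwards [htransition, h] with ω h2 h3 hω
    rw [← h3 hω]
    exact h2

variable {νh νv : PMF ℕ+} {ph pv : unitInterval}

/-- If the first `n` letters are those of the word `u`, which ends with `a` letters `l`, then the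
next ones form `w` with the conditional probability
`wordWeight l a w / survivalOf (byAxis νh νv l) a`. -/
theorem measure_initial_letters_append_mul (hq : IsGeneralizedDRRW q νh νv ph pv)
    (hU : IsVLMC μ q U) (w : List Letter) {n : ℕ} (hn : 1 ≤ n) (u : List Letter) {l : Letter}
    {a : ℕ+} (ha : survivalOf (byAxis νh νv l) a ≠ 0)
    (hpref : ∀ᵐ ω ∂μ, initial (letters U ω) n = u →
      ∃ l', ∃ h : Occurs ph pv l' l, pref (U n ω) = .run l l' h.1 a) :
    μ {ω | initial (letters U ω) (n + w.length) = u ++ w} * survivalOf (byAxis νh νv l) a =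
      μ {ω | initial (letters U ω) n = u} * wordWeight νh νv ph pv l a w := by
  induction w generalizing n u l a with
  | nil => simp [wordWeight]
  | cons m w ih =>
    have hword : {ω | initial (letters U ω) (n + (m :: w).length) = u ++ m :: w} =
        {ω | initial (letters U ω) (n + 1 + w.length) = u ++ [m] ++ w} := by
      rw [List.length_cons, List.append_assoc, List.singleton_append,
        show n + (w.length + 1) = n + 1 + w.length by ring]
    have hnull (h0 : μ {ω | initial (letters U ω) (n + 1) = u ++ [m]} = 0) :
        μ {ω | initial (letters U ω) (n + (m :: w).length) = u ++ m :: w} = 0 := by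
      refine measure_mono_null (fun ω hω => ?_) h0
      rw [hword] at hω
      change initial _ _ = _ at hω ⊢
      have hlen := congrArg List.length hω
      simp only [initial, List.length_map, List.length_range, List.length_append] at hlen
      rw [← take_initial _ (Nat.le_add_right (n + 1) w.length), hω]
      exact List.take_left' (by rw [List.length_append]; omega)
    have hstep : μ {ω | initial (letters U ω) (n + 1) = u ++ [m]} * survivalOf (byAxis νh νv l) a =
        μ {ω | initial (letters U ω) n = u} * stepWeight νh νv ph pv l a m := by
      have htop := survivalOf_ne_top (byAxis νh νv l) a
      have hstep_ne_top : stepWeight νh νv ph pv l a m ≠ ∞ := by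
        rw [stepWeight]
        split_ifs
        · exact survivalOf_ne_top _ _
        · refine ENNReal.mul_ne_top (PMF.apply_ne_top _ _) ?_
          rw [turnWeight]; split_ifs <;> exact ENNReal.ofReal_ne_top
      rw [measure_initial_letters_append hU hn u m
        (c := stepWeight νh νv ph pv l a m / survivalOf (byAxis νh νv l) a)
        (ENNReal.div_ne_top hstep_ne_top ha), mul_assoc, ENNReal.div_mul_cancel ha htop]
      filter_upwards [hpref] with ω hω hu
      obtain ⟨l', h, hp⟩ := hω hu
      rw [hp, ENNReal.eq_div_iff ha htop]
      exact survivalOf_mul_apply hq h ha m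
    rw [stepWeight] at hstep
    rw [wordWeight]
    split_ifs at hstep ⊢ with hm
    · subst hm
      -- If runs of length `a + 1` do not exist, both sides vanish.
      by_cases h1 : survivalOf (byAxis νh νv m) (a + 1) = 0
      · rw [h1, mul_zero, mul_eq_zero, or_iff_left ha] at hstep
        rw [hnull hstep, wordWeight_eq_zero h1, zero_mul, mul_zero]
      · have h2 := ih (n := n + 1) (by omega) (u ++ [m]) h1 (by
          filter_upwards [hpref, hU.append n] with ω hω happ hu
          rw [initial_succ_eq_append_iff] at hu
          obtain ⟨l', h, hp⟩ := hω hu.1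
          refine ⟨l', h, ?_⟩
          rw [happ, show U (n + 1) ω 0 = m from hu.2]
          exact pref_append_self hp)
        rw [hword]
        refine (ENNReal.mul_left_inj h1 (survivalOf_ne_top _ _)).1 ?_
        rw [mul_right_comm, h2, mul_right_comm, hstep, mul_right_comm]
    · by_cases ho : Occurs ph pv l m
      · have h2 := ih (n := n + 1) (by omega) (u ++ [m]) (l := m) (a := 1)
          (by rw [survivalOf_one]; exact one_ne_zero) (by
          filter_upwards [hpref, hU.append n] with ω hω happ hu
          rw [initial_succ_eq_append_iff] at hu
          obtain ⟨l', h, hp⟩ := hω hu.1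
          have h0 := eq_of_pref_eq_run hp
          refine ⟨l, ho, ?_⟩
          rw [happ, show U (n + 1) ω 0 = m from hu.2]
          subst h0
          exact pref_append_of_ne _)
        rw [survivalOf_one, mul_one] at h2
        rw [hword, h2, mul_right_comm, hstep, mul_assoc]
      -- A U-turn that is not considered in the hypotheses has probability zero.
      · have hzero : turnWeight ph pv l m = 0 := by
          have : ¬ (l.Orthogonal m ∨ 0 < byAxis ph pv m) := fun h => ho ⟨Ne.symm hm, h⟩
          push Not at this
          have hopp : m = l.opp := by
            cases l <;> cases m <;>
              simp_all [Letter.Orthogonal, Letter.IsHorizontal, Letter.opp]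
          have hax : byAxis ph pv m = byAxis ph pv l := by
            rw [hopp]; cases l <;> simp [byAxis, Letter.IsHorizontal, Letter.opp]
          rw [turnWeight, if_pos hopp, ENNReal.ofReal_eq_zero, ← hax]
          exact this.2
        rw [hzero, mul_zero, mul_zero, mul_eq_zero, or_iff_left ha] at hstep
        rw [hnull hstep, hzero, mul_zero, zero_mul, zero_mul, mul_zero]

/-- The distribution of the first letters written by the chain. -/
theorem measure_initial_letters (hq : IsGeneralizedDRRW q νh νv ph pv) (hU : IsVLMC μ q U)
    (hstart : ∀ᵐ ω ∂μ, (U 0 ω 0).IsVertical ∧ (U 1 ω 0).IsHorizontal) (m : Letter)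
    (w : List Letter) :
    μ {ω | initial (letters U ω) (w.length + 1) = m :: w} =
      μ {ω | U 1 ω 0 = m} * wordWeight νh νv ph pv m 1 w := by
  have h := measure_initial_letters_append_mul hq hU w le_rfl [m] (l := m) (a := 1)
    (by rw [survivalOf_one]; exact one_ne_zero) (by
      filter_upwards [hstart, hU.append 0] with ω hω happ hu
      have hu' : U 1 ω 0 = m := by simpa [initial, letters] using hu
      rw [hu'] at hω
      have ho : Letter.Orthogonal (U 0 ω 0) m := fun h => hω.1 (h.2 hω.2)
      have hne : U 0 ω 0 ≠ m := fun h => ho (by rw [h])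
      refine ⟨U 0 ω 0, ⟨hne, Or.inl ho⟩, ?_⟩
      rw [happ, hu']
      exact pref_append_of_ne hne)
  rw [survivalOf_one, mul_one] at h
  rw [add_comm]
  convert! h using 3
  simp [initial, letters]

end Chain

/-! ### Comparison of the laws and conclusion -/

/-- The infinite words that start with the finite word `c`. -/
def prefixCylinder (c : List Letter) : Set (ℕ → Letter) := {x | initial x c.length = c}

theorem prefixCylinder_inter_of_length_le {c c' : List Letter} (hc : c.length ≤ c'.length)
    (h : (prefixCylinder c ∩ prefixCylinder c').Nonempty) : prefixCylinder c ∩ prefixCylinder c' = prefixCylinder c' := by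
  obtain ⟨x, hx, hx'⟩ := h
  refine Set.inter_eq_right.2 fun y hy => ?_
  change initial _ _ = _ at hx hx' hy ⊢
  rw [← take_initial y hc, hy, ← hx', take_initial x hc, hx]

theorem isPiSystem_prefixCylinders : IsPiSystem {S | ∃ m w, S = prefixCylinder (m :: w)} := by
  rintro _ ⟨m, w, rfl⟩ _ ⟨m', w', rfl⟩ h
  rcases le_total (m :: w).length (m' :: w').length with hl | hl
  · exact ⟨m', w', prefixCylinder_inter_of_length_le hl h⟩
  · rw [Set.inter_comm] at h ⊢
    exact ⟨m, w, prefixCylinder_inter_of_length_le hl h⟩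

theorem measurableSet_prefixCylinder (c : List Letter) : MeasurableSet (prefixCylinder c) :=
  measurable_initial (X := id) c.length (fun k _ => measurable_pi_apply k)
    (MeasurableSet.of_discrete (s := {c}))

theorem generateFrom_prefixCylinders : (inferInstance : MeasurableSpace (ℕ → Letter)) =
    MeasurableSpace.generateFrom {S | ∃ m w, S = prefixCylinder (m :: w)} := by
  refine le_antisymm (iSup_le fun k => ?_) (MeasurableSpace.generateFrom_le ?_)
  · rintro _ ⟨A, -, rfl⟩
    have h : (fun x : ℕ → Letter => x k) ⁻¹' A = ⋃ c ∈ {c : List Letter | c.length = k + 1 ∧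
        c.getD k .e ∈ A}, prefixCylinder c := by
      ext x
      have hx (j : ℕ) (hj : k < j) : (initial x j).getD k .e = x k := by
        simp [initial, hj]
      simp only [Set.mem_preimage, Set.mem_iUnion, prefixCylinder, Set.mem_ofPred_eq, exists_prop]
      constructor
      · intro h
        exact ⟨initial x (k + 1), ⟨by simp [initial], by rwa [hx _ k.lt_succ_self]⟩,
          by simp [initial]⟩
      · rintro ⟨c, ⟨h1, h2⟩, h3⟩
        rwa [← h3, h1, hx _ k.lt_succ_self] at h2
    rw [h]
    refine MeasurableSet.biUnion (Set.to_countable _) fun c hc => ?_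
    obtain ⟨m, w, rfl⟩ := List.exists_cons_of_length_eq_add_one hc.1
    exact MeasurableSpace.measurableSet_generateFrom ⟨m, w, rfl⟩
  · rintro _ ⟨m, w, rfl⟩
    exact measurableSet_prefixCylinder _

theorem measurable_path : Measurable path :=
  measurable_pi_lambda _ fun k =>
    (Measurable.of_discrete (f := fun c : List Letter => c.getD k .e)).comp
      (measurable_concat (k + 1))

/-- The infinite words along which the walk visits the origin infinitely often. -/
def recurrentWords : Set (ℕ → Letter) := {x | ∃ᶠ n in atTop, ∑ k ∈ Finset.range n, (x k).dir = 0}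

theorem measurableSet_recurrentWords : MeasurableSet recurrentWords := by
  have h (n : ℕ) : MeasurableSet {x : ℕ → Letter | ∑ k ∈ Finset.range n, (x k).dir = 0} :=
    (Finset.measurable_fun_sum _ fun k _ => (Measurable.of_discrete (f := Letter.dir)).comp
      (measurable_pi_apply k)) (MeasurableSet.of_discrete (s := {0}))
  convert MeasurableSet.measurableSet_limsup h using 1
  ext x
  rw [Filter.mem_limsup_iff_frequently_mem]
  rfl

theorem walk_eq_sum_letters {Ω : Type*} (U : ℕ → Ω → Word) (n : ℕ) (ω : Ω) :
    walk U n ω = ∑ k ∈ Finset.range n, (letters U ω k).dir := by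
  change _ = ∑ k ∈ Finset.range n, (U (k + 1) ω 0).dir
  rw [walk, Finset.range_eq_Ico, Finset.sum_Ico_add' (fun k => (U k ω 0).dir) 0 n 1, zero_add,
    Finset.Ico_add_one_right_eq_Icc]

section Law

variable {Ω : Type*} [MeasurableSpace Ω] {μ : Measure Ω} [IsProbabilityMeasure μ] {q : ProbTree}
  {U : ℕ → Ω → Word} {νh νv : PMF ℕ+} {ph pv : unitInterval}

/-- The letters of the chain have the law of the concatenated half-cycles, weighted according to
the first letter: this letter is uniform on the horizontal letters for the half-cycles, but has an
arbitrary law on them for the chain. -/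
theorem map_letters_eq_withDensity (hph : ph < 1) (hpv : pv < 1)
    (hq : IsGeneralizedDRRW q νh νv ph pv) (hU : IsVLMC μ q U)
    (hstart : ∀ᵐ ω ∂μ, (U 0 ω 0).IsVertical ∧ (U 1 ω 0).IsHorizontal) :
    μ.map (letters U) = ((wordMeasure νh νv ph pv).map path).withDensity
      fun x => 2 * μ {ω | U 1 ω 0 = x 0} := by
  refine Measure.ext_of_generateFrom_of_cover_subset generateFrom_prefixCylinders isPiSystem_prefixCylinders
    (T := Set.range fun m => prefixCylinder [m]) ?_ (Set.countable_range _) ?_ ?_ ?_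
  · rintro _ ⟨m, rfl⟩
    exact ⟨m, [], rfl⟩
  · refine Set.eq_univ_of_forall fun x => ⟨_, ⟨x 0, rfl⟩, ?_⟩
    simp [prefixCylinder, initial]
  · rintro _ ⟨m, rfl⟩
    rw [Measure.map_apply (measurable_letters hU) (measurableSet_prefixCylinder _)]
    exact measure_ne_top _ _
  · rintro _ ⟨m, w, rfl⟩
    have hm := measurableSet_prefixCylinder (m :: w)
    have hconst : Set.EqOn (fun x : ℕ → Letter => 2 * μ {ω | U 1 ω 0 = x 0})
        (fun _ => 2 * μ {ω | U 1 ω 0 = m}) (prefixCylinder (m :: w)) := by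
      intro x hx
      change initial x (m :: w).length = m :: w at hx
      have : x 0 = m := by
        rw [List.length_cons, initial, List.range_succ_eq_map, List.map_cons] at hx
        exact (List.cons.inj hx).1
      simp only [this]
    have h1 : μ (letters U ⁻¹' prefixCylinder (m :: w)) =
        μ {ω | U 1 ω 0 = m} * wordWeight νh νv ph pv m 1 w :=
      measure_initial_letters hq hU hstart m w
    have h2 : wordMeasure νh νv ph pv (path ⁻¹' prefixCylinder (m :: w)) = _ :=
      measure_initial_path νh νv hph hpv m w
    rw [Measure.map_apply (measurable_letters hU) hm, withDensity_apply _ hm,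
      setLIntegral_congr_fun hm hconst, setLIntegral_const, Measure.map_apply measurable_path hm,
      h1, h2]
    split_ifs with hh
    · rw [mul_comm 2, mul_assoc, ← mul_assoc 2, ENNReal.mul_inv_cancel two_ne_zero ENNReal.ofNat_ne_top,
        one_mul]
    · have h0 : μ {ω | U 1 ω 0 = m} = 0 := by
        rw [measure_eq_zero_iff_ae_notMem]
        filter_upwards [hstart] with ω hω h
        exact hh ((show U 1 ω 0 = m from h) ▸ hω.2)
      rw [h0, zero_mul, mul_zero, mul_zero, zero_mul]

/-- Recurrence is read off the half-cycles, whose law dominates that of the letters of the chain;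
both directions rest on the zero-one law. -/
theorem originRecurrent_walk_iff (hph : ph < 1) (hpv : pv < 1)
    (hq : IsGeneralizedDRRW q νh νv ph pv) (hU : IsVLMC μ q U)
    (hstart : ∀ᵐ ω ∂μ, (U 0 ω 0).IsVertical ∧ (U 1 ω 0).IsHorizontal) :
    OriginRecurrent μ (walk U) ↔
      wordMeasure νh νv ph pv {ω | ∃ᶠ i in atTop, SegmentHits i ω} ≠ 0 := by
  set Q := wordMeasure νh νv ph pv
  have hac : μ.map (letters U) ≪ Q.map path := by
    rw [map_letters_eq_withDensity hph hpv hq hU hstart]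
    exact withDensity_absolutelyContinuous _ _
  have hmeas := measurableSet_recurrentWords
  have hrec : OriginRecurrent μ (walk U) ↔ ∀ᵐ ω ∂μ, letters U ω ∈ recurrentWords := by
    simp only [OriginRecurrent, walk_eq_sum_letters]
    rfl
  have hpath : ∀ᵐ ω ∂Q, path ω ∈ recurrentWords ↔ ∃ᶠ i in atTop, SegmentHits i ω := by
    filter_upwards [ae_isAxisWord νh νv ph pv] with ω hω
    exact frequently_sum_path_eq_zero_iff fun i => (hω i).1
  rw [hrec]
  constructor
  · intro h h0
    have h1 : Q.map path recurrentWords = 0 := by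
      rw [Measure.map_apply measurable_path hmeas, ← h0]
      exact measure_congr (hpath.mono fun ω hω => propext hω)
    have h2 := hac h1
    rw [Measure.map_apply (measurable_letters hU) hmeas, measure_eq_zero_iff_ae_notMem] at h2
    obtain ⟨ω, h3, h4⟩ := (h.and h2).exists
    exact h4 h3
  · intro h
    have h1 := (measure_frequently_segmentHits_eq_zero_or_one νh νv ph pv).resolve_left h
    have h2 : ∀ᵐ x ∂Q.map path, x ∈ recurrentWords := by
      refine (ae_map_iff measurable_path.aemeasurable hmeas).2 ?_
      have h3 : ∀ᵐ ω ∂Q, ∃ᶠ i in atTop, SegmentHits i ω :=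
        (mem_ae_iff_prob_eq_one₀ (measurableSet_frequently_segmentHits).nullMeasurableSet).2 h1
      filter_upwards [hpath, h3] with ω h4 h5
      exact h4.2 h5
    exact (ae_map_iff (measurable_letters hU).aemeasurable hmeas).1 (hac.ae_le h2)

end Law

section Series

variable {νh νv : PMF ℕ+} {ph pv : unitInterval}

/-- If the series with index `d` converges, then so does the series of the probabilities to visit
the origin during the half-cycles of parity `d`. -/
theorem tsum_measure_segmentHits_ne_top {d : ℕ} (hd : d ≤ 1) (hp : byParity ph pv d < 1)
    (h : ∑' n, convPow (jumpLaw (byParity νh νv (1 - d)) (byParity ph pv (1 - d))) (n + 1) {0} *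
      crossProb (jumpLaw (byParity νh νv d) (byParity ph pv d)) n ≠ ∞) :
    ∑' n, wordMeasure νh νv ph pv {ω | SegmentHits (2 * n + d) ω} ≠ ∞ := by
  refine ne_top_of_le_ne_top ?_ (ENNReal.tsum_le_tsum (measure_segmentHits_le νh νv ph pv hd hp))
  have hC : 2 * (ENNReal.ofReal (1 - byParity ph pv d))⁻¹ ≠ ∞ :=
    ENNReal.mul_ne_top ENNReal.ofNat_ne_top
      (ENNReal.inv_ne_top.2 (ENNReal.ofReal_pos.2 (sub_pos.2 hp)).ne')
  set κ := jumpLaw (byParity νh νv d) (byParity ph pv d)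
  set κ' := jumpLaw (byParity νh νv (1 - d)) (byParity ph pv (1 - d))
  rw [ENNReal.tsum_mul_left]
  refine ENNReal.mul_ne_top hC ?_
  have hfin : crossProb κ 0 ≠ ∞ := measure_ne_top _ _
  -- For `d = 0`, the walk on the other axis has made one jump less than in the series.
  interval_cases d
  · rw [tsum_eq_zero_add' ENNReal.summable]
    refine ENNReal.add_ne_top.2 ⟨ENNReal.mul_ne_top (measure_ne_top _ _) hfin, ?_⟩
    refine ne_top_of_le_ne_top (ENNReal.mul_ne_top (by norm_num : (72 : ℝ≥0∞) ≠ ∞) h) ?_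
    rw [← ENNReal.tsum_mul_left]
    refine ENNReal.tsum_le_tsum fun n => ?_
    rw [mul_left_comm, add_zero]
    gcongr
    exact crossProb_succ_le (map_neg_jumpLaw _ _) n
  · exact h

theorem measure_frequently_segmentHits_ne_zero_iff (hph : ph < 1) (hpv : pv < 1) :
    wordMeasure νh νv ph pv {ω | ∃ᶠ i in atTop, SegmentHits i ω} ≠ 0 ↔
      (∑' n, convPow (jumpLaw νh ph) (n + 1) {0} * crossProb (jumpLaw νv pv) n = ∞ ∨
        ∑' n, convPow (jumpLaw νv pv) (n + 1) {0} * crossProb (jumpLaw νh ph) n = ∞) := by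
  have h1 := measure_frequently_segmentHits_ne_zero νh νv ph pv (d := 1) le_rfl
  have h0 := measure_frequently_segmentHits_ne_zero νh νv ph pv (d := 0) zero_le_one
  have h1' := tsum_measure_segmentHits_ne_top (νh := νh) (νv := νv) (d := 1) le_rfl
    (byParity_lt_one hph hpv 1)
  have h0' := tsum_measure_segmentHits_ne_top (νh := νh) (νv := νv) (d := 0) zero_le_one
    (byParity_lt_one hph hpv 0)
  simp only [byParity, Nat.sub_self, Nat.sub_zero, Even.zero, Nat.not_even_one, if_true,
    if_false] at h0 h1 h0' h1'
  refine ⟨fun h => ?_, fun h => h.elim h1 h0⟩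
  contrapose! h
  have hsum : ∑' i, wordMeasure νh νv ph pv {ω | SegmentHits i ω} ≠ ∞ := by
    rw [← tsum_even_add_odd ENNReal.summable ENNReal.summable]
    exact ENNReal.add_ne_top.2 ⟨h0' h.2, h1' h.1⟩
  refine measure_mono_null (fun ω hω => ?_) (measure_limsup_atTop_eq_zero hsum)
  rw [Filter.mem_limsup_iff_frequently_mem]
  exact hω

end Series

namespace IsRandomWalk

variable {Ω : Type*} [MeasurableSpace Ω] {P : Measure Ω} {κ : Measure ℤ} {M : ℕ → Ω → ℤ}

theorem ae_eq_sum (hM : IsRandomWalk P κ M) (n : ℕ) :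
    ∀ᵐ ω ∂P, ∑ i ∈ Finset.range n, (M (i + 1) ω - M i ω) = M n ω := by
  filter_upwards [hM.zero] with ω hω
  rw [Finset.sum_range_sub (fun i => M i ω), hω, sub_zero]

theorem measurable_jump (hM : IsRandomWalk P κ M) (n : ℕ) :
    Measurable fun ω => M (n + 1) ω - M n ω := (hM.measurable _).sub (hM.measurable _)

variable [IsProbabilityMeasure P]

theorem measure_eq_zero (hM : IsRandomWalk P κ M) (n : ℕ) :
    P {ω | M n ω = 0} = convPow κ n {0} := by
  rw [← map_sum_range_eq_convPow hM.measurable_jump hM.indep hM.jump_law,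
    Measure.map_apply (Finset.measurable_fun_sum _ fun i _ => hM.measurable_jump i) .of_discrete]
  refine measure_congr ?_
  filter_upwards [hM.ae_eq_sum n] with ω hω
  refine propext ?_
  change M n ω = 0 ↔ ∑ i ∈ Finset.range n, (M (i + 1) ω - M i ω) = 0
  rw [hω]

theorem measure_crossing (hM : IsRandomWalk P κ M) (n : ℕ) :
    P {ω | 0 ≤ M n ω ∧ M n ω ≤ M (n + 1) ω - M n ω} = crossProb κ n := by
  rw [crossProb, ← map_sum_range_prodMk hM.measurable_jump hM.indep hM.jump_law,
    Measure.map_apply ((Finset.measurable_fun_sum _ fun i _ => hM.measurable_jump i).prodMk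
      (hM.measurable_jump n)) .of_discrete]
  refine measure_congr ?_
  filter_upwards [hM.ae_eq_sum n] with ω hω
  refine propext ?_
  change _ ↔ 0 ≤ ∑ i ∈ Finset.range n, (M (i + 1) ω - M i ω) ∧
    ∑ i ∈ Finset.range n, (M (i + 1) ω - M i ω) ≤ M (n + 1) ω - M n ω
  rw [hω]
  rfl

end IsRandomWalk

end QuadComb

theorem corollary1
    {Ω : Type*} [MeasurableSpace Ω] (μ : Measure Ω) [IsProbabilityMeasure μ]
    {Ω' : Type*} [MeasurableSpace Ω'] (P : Measure Ω') [IsProbabilityMeasure P]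
    (νh νv : PMF ℕ+) (ph pv : unitInterval) (hph : ph < 1) (hpv : pv < 1)
    (q : QuadComb.ProbTree) (hq : QuadComb.IsGeneralizedDRRW q νh νv ph pv)
    (U : ℕ → Ω → QuadComb.Word) (hU : QuadComb.IsVLMC μ q U)
    (hstart : ∀ᵐ ω ∂μ, (U 0 ω 0).IsVertical ∧ (U 1 ω 0).IsHorizontal)
    (H V : ℕ → Ω' → ℤ)
    (hH : QuadComb.IsRandomWalk P (QuadComb.jumpLaw νh ph) H)
    (hV : QuadComb.IsRandomWalk P (QuadComb.jumpLaw νv pv) V)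
    (hHV : IndepFun (fun ω n => H n ω) (fun ω n => V n ω) P) :
    QuadComb.OriginRecurrent μ (QuadComb.walk U) ↔
      ((∑' n : ℕ, P {ω | H (n + 1) ω = 0} *
          P {ω | 0 ≤ V n ω ∧ V n ω ≤ V (n + 1) ω - V n ω} = ∞) ∨
        (∑' n : ℕ, P {ω | V (n + 1) ω = 0} *
          P {ω | 0 ≤ H n ω ∧ H n ω ≤ H (n + 1) ω - H n ω} = ∞)) := by
  rw [QuadComb.originRecurrent_walk_iff hph hpv hq hU hstart,
    QuadComb.measure_frequently_segmentHits_ne_zero_iff hph hpv]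
  simp only [hH.measure_eq_zero, hV.measure_eq_zero, hH.measure_crossing, hV.measure_crossing]
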